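/- **Theorem 3.2.** Let $o\in\mathcal X$ be a germ of a normal complex algebraic variety with $\dim\mathcal X\geqslant 3$, non-singular outside the closed point $o$. Let $\varphi\colon\mathcal X^+\to\mathcal X$ be the blow up of the point $o$ and $\mathcal Q=\varphi^{-1}(o)$ its exceptional divisor (the scheme-theoretic fibre). Assume that $\mathcal Q$ is irreducible, reduced and non-singular in codimension $1$, that is, $\operatorname{codim}(\operatorname{Sing}\mathcal Q\subset\mathcal Q)\geqslant 2$, and that the discrepancy $a(\mathcal Q,\mathcal X)$ is defined (the canonical class of $\mathcal X$ is $\mathbb Q$-Cartier) and equal to $1$. Let $n\geqslant 1$ be an integer and $\mathcal D$ an effective divisor on $\mathcal X$ whose strict transform $\mathcal D^+$ on $\mathcal X^+$ satisfies $$\mathcal D^+\sim-\nu_{\mathcal D}\,\mathcal Q,\qquad \nu_{\mathcal D}\in\mathbb Z,\quad \nu_{\mathcal D}\leqslant 2n.$$ Assume that the pair $(\mathcal X,\frac1n\mathcal D)$ is canonical outside the point $o$, that is, $\operatorname{ord}_{\mathcal E'}\mathcal D\leqslant n\,a(\mathcal E',\mathcal X)$ for every exceptional divisor $\mathcal E'$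 over $\mathcal X$ whose centre on $\mathcal X$ is not the point $o$, but that the pair is not log canonical. Namely, let $\mathcal E\neq\mathcal Q$ be an exceptional divisor over $\mathcal X$ that is a non log canonical singularity of this pair, that is, $$\operatorname{ord}_{\mathcal E}\mathcal D>n\,(a(\mathcal E,\mathcal X)+1),$$ and whose centre on $\mathcal X^+$ is an irreducible subvariety $\mathcal W\subset\mathcal Q$ with $\operatorname{codim}(\mathcal W\subset\mathcal Q)\geqslant 2$ and $\mathcal W\not\subset\operatorname{Sing}\mathcal Q$. Then at least one of the following two inequalities holds: (1) $\operatorname{mult}_{\mathcal W}\mathcal D^+>n$, (2) $\operatorname{mult}_{\mathcal W}(\mathcal D^+\circ\mathcal Q)>3n-\nu_{\mathcal D}$, where $(\mathcal D^+\circ\mathcal Q)$ is the restriction of the effective divisor $\mathcal D^+$ to $\mathcal Q$ (the scheme-theoretic intersection). -/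

import Mathlib

open scoped KaehlerDifferential ENat
open IsLocalRing

/-!
Birational geometry of a germ in the language of local rings in the function field.

Throughout, `A` is the local ring of a complex algebraic variety `X` at a closed point `o`, and `K`
is the function field of `X`. An integral separated scheme with function field `K` is recorded by
the set of its local rings, which are local subrings of `K`; a point is its local ring. For points
`S`, `T` of one such scheme, `T` is a specialization of `S` (`T` lies in the closure of `S`) iff
`T ⊆ S` as subrings of `K`. A valuation ring `E` of `K` has centre `S` on the scheme iff it
dominates `S`, which is the order `S ≤ E` of `LocalSubring K`.
-/

namespace LocalGerm

noncomputable section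

universe u v

section Models

variable {K : Type v} [Field K]

/-- The local rings, inside the field `K`, of the points of the affine scheme `Spec B`. -/
def affinePoints (B : Subring K) : Set (LocalSubring K) :=
  {S | ∃ (P : Ideal B) (_ : P.IsPrime), S = LocalSubring.ofPrime B P}

/-- The prime divisors of a model `M` (given by the set of its local rings): the points of `M`
of codimension one. -/
def primeDivisors (M : Set (LocalSubring K)) : Set (LocalSubring K) :=
  {P | P ∈ M ∧ ringKrullDim P.toSubring = 1}

/-- `x` has order `k` with respect to the discrete valuation ring `P ⊆ K`: `x = u π ^ k`, where `u`
is a unit of `P` and `π` is a generator of the maximal ideal of `P`. In particular `x ≠ 0`. -/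
def HasOrd (P : LocalSubring K) (x : K) (k : ℤ) : Prop :=
  x ≠ 0 ∧ ∃ (π : P.toSubring) (w : P.toSubringˣ),
    maximalIdeal P.toSubring = Ideal.span {π} ∧ x = ((w : P.toSubring) : K) * (π : K) ^ k

/-- `D` is an effective Weil divisor on the model `M`. (A divisor is a finitely supported
integral function on its prime divisors, extended by zero to all local subrings of `K`.) -/
def IsEffectiveDivisor (M : Set (LocalSubring K)) (D : LocalSubring K →₀ ℤ) : Prop :=
  (∀ P, 0 ≤ D P) ∧ ∀ P, D P ≠ 0 → P ∈ primeDivisors M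

open Classical in
/-- The strict transform of the divisor `D` on a birational model `M`: every component of `D` is
replaced by the prime divisor of `M` with the same generic point, that is, with the same local
ring in `K`, and by zero if there is none. -/
def strictTransform (M : Set (LocalSubring K)) (D : LocalSubring K →₀ ℤ) :
    LocalSubring K →₀ ℤ :=
  D.filter (fun P => P ∈ primeDivisors M)

/-- Linear equivalence of divisors on the model `M`: their difference is the divisor of a
rational function. -/
def LinEquiv (M : Set (LocalSubring K)) (D D' : LocalSubring K →₀ ℤ) : Prop :=
  ∃ h : K, ∀ P ∈ primeDivisors M, HasOrd P h (D P - D' P)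

/-- `f` is a local equation of the effective divisor `D` at the point `S` of the model `M`: the
divisor of `f` agrees with `D` along all prime divisors of `M` through `S`. -/
def IsLocalEquation (M : Set (LocalSubring K)) (S : LocalSubring K) (D : LocalSubring K →₀ ℤ)
    (f : S.toSubring) : Prop :=
  ∀ P ∈ primeDivisors M, S.toSubring ≤ P.toSubring → HasOrd P (f : K) (D P)

/-- The largest `k` with `f ∈ I ^ k` (infinite if there is no largest one). For the maximal ideal
`I` of a regular local ring this is the multiplicity of the divisor `f = 0` at the closed point. -/
def orderIn {R : Type*} [CommRing R] (I : Ideal R) (f : R) : ℕ∞ :=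
  ⨆ (k : ℕ) (_ : f ∈ I ^ k), (k : ℕ∞)

/-- The multiplicity of the divisor `D` on the model `M` along (the closure of) a regular point `S`
of `M`: the order of a local equation of `D` at `S`. (Local equations at a normal point differ by
units, so that the supremum is over one value.) -/
def multAlong (M : Set (LocalSubring K)) (S : LocalSubring K) (D : LocalSubring K →₀ ℤ) : ℕ∞ :=
  ⨆ (f : S.toSubring) (_ : IsLocalEquation M S D f), orderIn (maximalIdeal S.toSubring) f

/-- Let `I` be the ideal, in the local ring of the point `S` of `M`, of a closed subscheme that is
regular at `S`. This is the multiplicity along (the closure of) `S` of the restriction of the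
divisor `D` to that subscheme: the order of the image of a local equation of `D` in the local ring
`S ⧸ I` of the subscheme. -/
def multRestrictAlong (M : Set (LocalSubring K)) (S : LocalSubring K) (I : Ideal S.toSubring)
    (D : LocalSubring K →₀ ℤ) : ℕ∞ :=
  ⨆ (f : S.toSubring) (_ : IsLocalEquation M S D f),
    orderIn ((maximalIdeal S.toSubring).map (Ideal.Quotient.mk I)) (Ideal.Quotient.mk I f)

end Models

section Differentials

variable {K : Type v} [Field K] [Algebra ℂ K]

/-- The rational differential form `dx₁ ∧ ⋯ ∧ dx_d` over `ℂ`. -/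
def wedgeD {d : ℕ} (x : Fin d → K) : ⋀[K]^d Ω[K⁄ℂ] :=
  exteriorPower.ιMulti K d (fun i => KaehlerDifferential.D ℂ K (x i))

/-- The rational `d`-form `ω` (`d = dim X`) has order `k` along the prime divisor with the discrete
valuation ring `P`: `ω = g • (dx₁ ∧ ⋯ ∧ dx_d)`, where `g` has order `k` and `dx₁ ∧ ⋯ ∧ dx_d` with
`xᵢ ∈ P` generates over `P` the module of the `d`-forms that are regular along the divisor. -/
def HasOrdForm {d : ℕ} (P : LocalSubring K) (ω : ⋀[K]^d Ω[K⁄ℂ]) (k : ℤ) : Prop :=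
  ∃ (x : Fin d → P.toSubring) (g : K),
    wedgeD (fun i => (x i : K)) ≠ 0 ∧
    (∀ y : Fin d → P.toSubring, ∃ c : P.toSubring,
      wedgeD (fun i => (y i : K)) = (c : K) • wedgeD (fun i => (x i : K))) ∧
    ω = g • wedgeD (fun i => (x i : K)) ∧ HasOrd P g k

end Differentials

section Germ

variable (A : Type u) [CommRing A] [IsDomain A] [IsLocalRing A]
variable (K : Type v) [Field K] [Algebra A K]

/-- `A` is the local ring of a normal `d`-dimensional complex algebraic variety at a closed point
`o`, and the variety is non-singular in a punctured neighbourhood of `o`. -/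
structure IsIsolatedGerm [Algebra ℂ A] (d : ℕ) : Prop where
  essFiniteType : Algebra.EssFiniteType ℂ A
  closedPoint : Function.Surjective (algebraMap ℂ (ResidueField A))
  dim_eq : ringKrullDim A = d
  normal : IsIntegrallyClosed A
  isolated : ∀ (P : Ideal A) [P.IsPrime], P ≠ maximalIdeal A →
    IsRegularLocalRing (Localization.AtPrime P)

/-- The points of the germ `X = Spec A`, as local rings in `K`. -/
def germ : Set (LocalSubring K) := affinePoints (algebraMap A K).range

/-- The affine coordinate ring `A[𝔪 / x] ⊆ K` of the chart of the blow-up of `o` defined by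
an element `x` of the maximal ideal `𝔪` of `A`. -/
def blowupChart (x : A) : Subalgebra A K :=
  Algebra.adjoin A {z | ∃ y ∈ maximalIdeal A, z = algebraMap A K y / algebraMap A K x}

/-- The points of the blow-up `X⁺` of `X = Spec A` at the closed point `o`, as local rings
in `K`: it is the union of the affine charts `Spec A[𝔪 / x]`, `0 ≠ x ∈ 𝔪`. -/
def blowup : Set (LocalSubring K) :=
  {S | ∃ x ∈ maximalIdeal A, x ≠ 0 ∧ S ∈ affinePoints (blowupChart A K x).toSubring}

variable {K}

/-- The ideal `𝔪 S` generated by the maximal ideal `𝔪` of `A` in a local ring `S ⊆ K` containing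
`A`. At the points of the blow-up, it is the ideal of the exceptional divisor, the
scheme-theoretic inverse image of `o`. -/
def excIdeal (S : LocalSubring K) : Ideal S.toSubring :=
  Ideal.span {s | ∃ a ∈ maximalIdeal A, (s : K) = algebraMap A K a}

/-- The local ring `S ⊆ K` lies over the closed point `o`: it contains `A` and its maximal ideal
contains the maximal ideal of `A`. -/
def LiesOver (S : LocalSubring K) : Prop :=
  (∀ a : A, algebraMap A K a ∈ S.toSubring) ∧ excIdeal A S ≤ maximalIdeal S.toSubring

variable (K) in
/-- The points of the exceptional divisor of the blow-up of `o`. -/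
def excPoints : Set (LocalSubring K) := {S | S ∈ blowup A K ∧ LiesOver A S}

/-- `E` is (the discrete valuation ring of) a prime divisor over `X = Spec A`, that is, the local
ring of a point of codimension one on a model of finite type over `X` with the function field `K`,
normal at that point. -/
def IsDivisorOver (E : LocalSubring K) : Prop :=
  IsDiscreteValuationRing E.toSubring ∧
    ∃ B : Subalgebra A K, B.FG ∧ E ∈ affinePoints B.toSubring

/-- `c` is the order along `E` of the pull-back of the divisor `D` on `X = Spec A`: some multiple
`r D` is a principal divisor on the germ, equal to `div g`, and `r c = ord_E g`. -/
def HasOrdAlong (E : LocalSubring K) (D : LocalSubring K → ℤ) (c : ℚ) : Prop :=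
  ∃ (r : ℕ) (g : K) (k : ℤ), 0 < r ∧
    (∀ P ∈ primeDivisors (germ A K), HasOrd P g (r * D P)) ∧
    HasOrd E g k ∧ (r : ℚ) * c = k

/-- `a = a(E, X)` is the discrepancy of the prime divisor `E` over the `d`-dimensional germ `X`. For
a rational `d`-form `ω`, with divisor `KX` on `X`, it is the order of `ω` along `E` minus the order
along `E` of the pull-back of `KX` (which has to be `ℚ`-Cartier). -/
def HasDiscrepancy [Algebra ℂ K] (d : ℕ) (E : LocalSubring K) (a : ℚ) : Prop :=
  ∃ (ω : ⋀[K]^d Ω[K⁄ℂ]) (KX : LocalSubring K → ℤ) (k : ℤ) (c : ℚ),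
    (∀ P ∈ primeDivisors (germ A K), HasOrdForm P ω (KX P)) ∧
    HasOrdForm E ω k ∧ HasOrdAlong A E KX c ∧ a = k - c

/-- Condition `(G)` for the blow-up of `o`, with `Q` the generic point of the exceptional divisor:
the exceptional divisor is irreducible, reduced and non-singular in codimension one, and its
discrepancy is equal to `1`. -/
structure ConditionG [Algebra ℂ K] (d : ℕ) (Q : LocalSubring K) : Prop where
  mem : Q ∈ excPoints A K
  irreducible : ∀ S ∈ excPoints A K, S.toSubring ≤ Q.toSubring
  reduced : ∀ S ∈ excPoints A K, (excIdeal A S).IsRadical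
  regular_codim_one : ∀ S ∈ excPoints A K, ringKrullDim (S.toSubring ⧸ excIdeal A S) ≤ 1 →
    IsRegularLocalRing (S.toSubring ⧸ excIdeal A S)
  discrepancy_eq_one : HasDiscrepancy A d Q 1

/-- `E`, a prime divisor over `X`, is a non log canonical singularity of the pair `(X, (1/n) D)`:
`ord_E D > n (a(E, X) + 1)`. -/
def IsNonLCSingularity [Algebra ℂ K] (d n : ℕ) (D : LocalSubring K →₀ ℤ) (E : LocalSubring K) :
    Prop :=
  IsDivisorOver A E ∧ E ∉ primeDivisors (germ A K) ∧
    ∃ a c : ℚ, HasDiscrepancy A d E a ∧ HasOrdAlong A E D c ∧ n * (a + 1) < c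

/-- The pair `(X, (1/n) D)` is canonical outside `o`: `ord_E D ≤ n a(E, X)` for every exceptional
prime divisor `E` over `X`, the centre of which on `X` is not the point `o`. -/
def IsCanonicalOutside [Algebra ℂ K] (d n : ℕ) (D : LocalSubring K →₀ ℤ) : Prop :=
  ∀ E : LocalSubring K, IsDivisorOver A E → E ∉ primeDivisors (germ A K) → ¬ LiesOver A E →
    ∀ a c : ℚ, HasDiscrepancy A d E a → HasOrdAlong A E D c → c ≤ n * a

end Germ

end

end LocalGerm

/-! Everything takes place in the local ring of the blow-up at `W`, with q a local equation of the
exceptional divisor. Write w = ord_E q, and let j be the order along `E` of the volume form dx₁ ∧ ⋯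
∧ dx_d of a coordinate system at `W` that contains q. A function h with divisor D⁺ + νQ on the
blow-up is an equation of D on the germ, and f = h q^(-ν) is an equation of D⁺ at `W`; hence ord_E D
= ord_E f + νw. Since `Q` has discrepancy 1, a(E, X) = w + j. The failure of log canonicity thus
reads ord_E f + (ν - n)w > n(j + 1).

So it is enough to prove a local bound: if c ≤ n, f has order at most n at `W`, and f restricted to
q = 0 has order at most 2n - c, then ord_E f + cw ≤ nA with A = j + 1. This is
`IsLogAdapted.add_mul_le`, transferred to the geometric setting by `hasOrd_add_mul_le`, and applied
with c = ν - n. It is proved by differentiation, without inversion of adjunction. Replacing two of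
the dxᵢ by dg and dh multiplies the volume form by a 2 × 2 Jacobian, so the bracket of g and h has
value at least v(g) + v(h) - A (`bracket_mem_ordFiltration`). Bracketing with q shows that the
derivations tangent to q = 0 lower values by at most A - w. Let C be the sharp cost of the
transversal derivation ∂ = ∂/∂q.

If C ≤ A - w, every derivation costs at most A - w; n derivatives turn f into a unit, so ord_E f ≤
n(A - w), which suffices. If C > A - w, bracketing with a function on which ∂ attains its cost shows
that on functions nearly constant along ∂ the tangential derivations cost only A - C. Such functions
are produced from f and its ∂-derivatives, without changing restrictions to q = 0, by a truncated
Taylor expansion (`taylorTrunc`). Consequently some ∂^i f with i ≤ n has value at most (2n - c)(A -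
C) - iw, and the cost iC of reaching it bounds ord_E f.

The remaining ingredients are coordinates on a regular local ring (`exists_coordinates`), the
primality of q together with the recovery of the ring at `W` from its height one localizations
(`exists_prime_excIdeal`, `mem_of_forall_hasOrd_of_mem_excPoints`), and the comparison of canonical
divisors in the final proof. -/

open scoped TensorProduct

namespace LocalGerm

noncomputable section

/-! ### Orders of vanishing and derivations in characteristic zero. -/

section DifferentialOrder

variable {R ι : Type*} [CommRing R] [Algebra ℂ R]

lemma derivation_mem_pow (δ : Derivation ℂ R R) (I : Ideal R) (k : ℕ) {f : R}
    (hf : f ∈ I ^ (k + 1)) : δ f ∈ I ^ k := by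
  induction k generalizing f with
  | zero => simp
  | succ k ih =>
    rw [pow_succ] at hf
    refine Submodule.mul_induction_on hf (fun a ha b hb => ?_) (fun a b ha hb => ?_)
    · rw [Derivation.leibniz, smul_eq_mul, smul_eq_mul]
      refine Ideal.add_mem _ (Ideal.mul_mem_right _ _ ha) ?_
      rw [pow_succ, mul_comm b]
      exact Ideal.mul_mem_mul (ih ha) hb
    · rw [map_add]; exact Ideal.add_mem _ ha hb

/-- As `δ` kills `q`, it descends to the hypersurface `q = 0`, where it again lowers orders by at
most one. -/
lemma derivation_mem_pow_sup_span (δ : Derivation ℂ R R) (I : Ideal R) (k : ℕ) {q f : R}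
    (hq : δ q = 0) (hf : f ∈ I ^ (k + 1) ⊔ Ideal.span {q}) : δ f ∈ I ^ k ⊔ Ideal.span {q} := by
  obtain ⟨s, hs, t, ht, rfl⟩ := Submodule.mem_sup.1 hf
  obtain ⟨g, rfl⟩ := Ideal.mem_span_singleton'.1 ht
  rw [map_add, Derivation.leibniz, hq, smul_zero, zero_add, smul_eq_mul]
  exact Submodule.add_mem_sup (derivation_mem_pow δ I k hs)
    (Ideal.mul_mem_right _ _ (Ideal.mem_span_singleton_self q))

/-- The Euler relation for the elements of `(x i)_{i ∈ T} ^ k`. -/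
lemma euler_sub_mem [DecidableEq ι] (δ : ι → Derivation ℂ R R) (x : ι → R)
    (hδ : ∀ i j, δ i (x j) = if i = j then 1 else 0) (T : Finset ι) (k : ℕ) {f : R}
    (hf : f ∈ Ideal.span (x '' T) ^ k) :
    ∑ i ∈ T, x i * δ i f - k * f ∈ Ideal.span (x '' T) ^ (k + 1) := by
  set m := Ideal.span (x '' (T : Set ι)) with hm
  have hx : ∀ i ∈ T, x i ∈ m := fun i hi => Ideal.subset_span ⟨i, hi, rfl⟩
  induction k generalizing f with
  | zero =>
    simp only [Nat.cast_zero, zero_mul, sub_zero, zero_add, pow_one]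
    exact Ideal.sum_mem _ fun i hi => Ideal.mul_mem_right _ _ (hx i hi)
  | succ k ih =>
    -- In degree one the Euler operator is the identity modulo `m ^ 2`; higher degrees follow from
    -- the Leibniz rule.
    have key : ∀ b ∈ m, ∑ i ∈ T, x i * δ i b - b ∈ m ^ 2 := by
      intro b hb
      refine Submodule.span_induction ?_ ?_ ?_ ?_ hb
      · rintro _ ⟨j, hj, rfl⟩
        have : ∑ i ∈ T, x i * δ i (x j) = x j := by
          simp only [hδ, mul_ite, mul_one, mul_zero]
          rw [Finset.sum_ite_eq' T j]; simp only [Finset.mem_coe] at hj; simp [hj]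
        rw [this, sub_self]; exact Ideal.zero_mem _
      · simp
      · intro a b _ _ ha hb
        have : ∑ i ∈ T, x i * δ i (a + b) - (a + b)
            = (∑ i ∈ T, x i * δ i a - a) + (∑ i ∈ T, x i * δ i b - b) := by
          simp only [map_add, mul_add, Finset.sum_add_distrib]; ring
        rw [this]; exact Ideal.add_mem _ ha hb
      · intro a b hb' hb
        have : ∑ i ∈ T, x i * δ i (a • b) - a • b
            = a * (∑ i ∈ T, x i * δ i b - b) + (∑ i ∈ T, x i * δ i a) * b := by
          simp only [smul_eq_mul, Derivation.leibniz, mul_add, Finset.sum_add_distrib, mul_sub,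
            Finset.mul_sum, Finset.sum_mul]
          have e1 : ∀ i, x i * (a * δ i b) = a * (x i * δ i b) := fun i => by ring
          have e2 : ∀ i, x i * (b * δ i a) = x i * δ i a * b := fun i => by ring
          simp only [e1, e2]; ring
        rw [this]
        refine Ideal.add_mem _ (Ideal.mul_mem_left _ _ hb) ?_
        rw [pow_two]
        exact Ideal.mul_mem_mul (Ideal.sum_mem _ fun i hi => Ideal.mul_mem_right _ _ (hx i hi)) hb'
    rw [pow_succ] at hf
    refine Submodule.mul_induction_on hf (fun a ha b hb => ?_) (fun a b ha hb => ?_)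
    · have : ∑ i ∈ T, x i * δ i (a * b) - ((k + 1 : ℕ) : R) * (a * b)
          = (∑ i ∈ T, x i * δ i a - k * a) * b + a * (∑ i ∈ T, x i * δ i b - b) := by
        simp only [smul_eq_mul, Derivation.leibniz, mul_add, Finset.sum_add_distrib, mul_sub,
          Finset.mul_sum, Finset.sum_mul, sub_mul]
        have e1 : ∀ i, x i * (a * δ i b) = a * (x i * δ i b) := fun i => by ring
        have e2 : ∀ i, x i * (b * δ i a) = x i * δ i a * b := fun i => by ring
        simp only [e1, e2]; push_cast; ring
      rw [this]
      refine Ideal.add_mem _ ?_ ?_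
      · rw [pow_succ]; exact Ideal.mul_mem_mul (ih ha) hb
      · rw [show k + 1 + 1 = k + 2 by ring, pow_add]; exact Ideal.mul_mem_mul ha (key b hb)
    · have : ∑ i ∈ T, x i * δ i (a + b) - ((k + 1 : ℕ) : R) * (a + b)
          = (∑ i ∈ T, x i * δ i a - ((k + 1 : ℕ) : R) * a)
            + (∑ i ∈ T, x i * δ i b - ((k + 1 : ℕ) : R) * b) := by
        simp only [map_add, mul_add, Finset.sum_add_distrib]; ring
      rw [this]; exact Ideal.add_mem _ ha hb

lemma mem_of_natCast_mul_mem {I : Ideal R} {k : ℕ} (hk : k ≠ 0) {f : R} (h : (k : R) * f ∈ I) :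
    f ∈ I := by
  have : f = algebraMap ℂ R (k : ℂ)⁻¹ * ((k : R) * f) := by
    rw [← mul_assoc, show (k : R) = algebraMap ℂ R k by simp, ← map_mul,
      inv_mul_cancel₀ (by exact_mod_cast hk), map_one, one_mul]
  rw [this]; exact Ideal.mul_mem_left _ _ h

/-- If all derivatives vanished to order `k + 1`, the Euler relation would put `(k + 1) * f` in the
next power, and `k + 1` is invertible. -/
lemma exists_derivation_notMem_pow [DecidableEq ι] (δ : ι → Derivation ℂ R R) (x : ι → R)
    (hδ : ∀ i j, δ i (x j) = if i = j then 1 else 0) (T : Finset ι) (k : ℕ) {f : R}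
    (hf : f ∈ Ideal.span (x '' T) ^ (k + 1)) (hf' : f ∉ Ideal.span (x '' T) ^ (k + 2)) :
    ∃ i ∈ T, δ i f ∉ Ideal.span (x '' T) ^ (k + 1) := by
  by_contra! h
  apply hf'
  refine mem_of_natCast_mul_mem (Nat.succ_ne_zero k) ?_
  have := euler_sub_mem δ x hδ T (k + 1) hf
  rw [← neg_sub, Ideal.neg_mem_iff] at this
  rw [← sub_add_cancel (((k + 1 : ℕ) : R) * f) (∑ i ∈ T, x i * δ i f)]
  refine Ideal.add_mem _ this (Ideal.sum_mem _ fun i hi => ?_)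
  rw [pow_succ', show k + 1 = k + 1 from rfl]
  exact Ideal.mul_mem_mul (Ideal.subset_span ⟨i, hi, rfl⟩) (h i hi)

/-- The same Euler argument on the hypersurface `x i₀ = 0`: there the `i₀` term of the Euler sum
vanishes, and the other derivations are tangent to it. -/
lemma exists_derivation_notMem_pow_sup [DecidableEq ι] (δ : ι → Derivation ℂ R R) (x : ι → R)
    (hδ : ∀ i j, δ i (x j) = if i = j then 1 else 0) (T : Finset ι) (i₀ : ι) (k : ℕ) {f : R}
    (hf : f ∈ Ideal.span (x '' T) ^ (k + 1) ⊔ Ideal.span {x i₀})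
    (hf' : f ∉ Ideal.span (x '' T) ^ (k + 2) ⊔ Ideal.span {x i₀}) :
    ∃ j ∈ T, j ≠ i₀ ∧ δ j f ∉ Ideal.span (x '' T) ^ (k + 1) ⊔ Ideal.span {x i₀} := by
  by_contra! h
  apply hf'
  obtain ⟨s, hs, t, ht, rfl⟩ := Submodule.mem_sup.1 hf
  refine Ideal.add_mem _ ?_ (Ideal.mem_sup_right ht)
  refine mem_of_natCast_mul_mem (Nat.succ_ne_zero k) ?_
  have := euler_sub_mem δ x hδ T (k + 1) hs
  rw [← neg_sub, Ideal.neg_mem_iff] at this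
  rw [← sub_add_cancel (((k + 1 : ℕ) : R) * s) (∑ i ∈ T, x i * δ i s)]
  refine Ideal.add_mem _ (Ideal.mem_sup_left this) (Ideal.sum_mem _ fun i hi => ?_)
  by_cases hi0 : i = i₀
  · subst hi0
    exact Ideal.mem_sup_right (Ideal.mul_mem_right _ _ (Ideal.mem_span_singleton_self _))
  have h1 := h i hi hi0
  obtain ⟨g, rfl⟩ := Ideal.mem_span_singleton'.1 ht
  have h2 : δ i s ∈ Ideal.span (x '' T) ^ (k + 1) ⊔ Ideal.span {x i₀} := by
    rw [map_add, Derivation.leibniz, hδ, if_neg hi0, smul_zero, zero_add, smul_eq_mul] at h1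
    exact (Ideal.add_mem_iff_left _ (Ideal.mem_sup_right
      (Ideal.mul_mem_right _ _ (Ideal.mem_span_singleton_self _)))).1 h1
  obtain ⟨a, ha, b, hb, hab⟩ := Submodule.mem_sup.1 h2
  rw [← hab, mul_add]
  refine Ideal.add_mem _ (Ideal.mem_sup_left ?_) (Ideal.mem_sup_right (Ideal.mul_mem_left _ _ hb))
  rw [pow_succ']
  exact Ideal.mul_mem_mul (Ideal.subset_span ⟨i, hi, rfl⟩) ha

/-- If `f` has order at most `n`, then for some `a` the restriction of the `a`-th derivative of `f`
in the direction transversal to `x i₀ = 0` has order at most `n - a`. -/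
lemma exists_iterate_derivation_notMem [DecidableEq ι] (δ : ι → Derivation ℂ R R) (x : ι → R)
    (hδ : ∀ i j, δ i (x j) = if i = j then 1 else 0)
    (hcomm : ∀ i j r, δ i (δ j r) = δ j (δ i r)) (T : Finset ι) (i₀ : ι) (hi₀ : i₀ ∈ T)
    (n : ℕ) {f : R} (hf : f ∉ Ideal.span (x '' T) ^ (n + 1)) :
    ∃ a ≤ n, (δ i₀)^[a] f ∉ Ideal.span (x '' T) ^ (n - a + 1) ⊔ Ideal.span {x i₀} := by
  have hle : Ideal.span {x i₀} ≤ Ideal.span (x '' (T : Set ι)) := by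
    rw [Ideal.span_le, Set.singleton_subset_iff]; exact Ideal.subset_span ⟨i₀, hi₀, rfl⟩
  induction n generalizing f with
  | zero =>
    refine ⟨0, le_rfl, ?_⟩
    simpa [sup_eq_left.2 hle] using hf
  | succ n ih =>
    by_cases h : f ∈ Ideal.span (x '' (T : Set ι)) ^ (n + 1)
    -- A derivative of exact order drop either is transversal, and is counted in `a`, or is tangent
    -- to `x i₀ = 0`; in the latter case it commutes past the transversal ones and lowers the
    -- restricted order by at most one.
    · obtain ⟨j, hj, hjf⟩ := exists_derivation_notMem_pow δ x hδ T n h hf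
      obtain ⟨a, ha, hfa⟩ := ih hjf
      by_cases hji : j = i₀
      · subst hji
        refine ⟨a + 1, by omega, ?_⟩
        rwa [Function.iterate_succ_apply, Nat.add_sub_add_right]
      · refine ⟨a, by omega, fun hmem => hfa ?_⟩
        have hc : ∀ (b : ℕ) (r : R), (δ i₀)^[b] (δ j r) = δ j ((δ i₀)^[b] r) := by
          intro b
          induction b with
          | zero => intro r; rfl
          | succ b ihb => intro r; rw [Function.iterate_succ_apply, hcomm, ihb,
              Function.iterate_succ_apply]
        rw [hc]
        refine derivation_mem_pow_sup_span (δ j) _ _ (by rw [hδ, if_neg hji]) ?_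
        rwa [show n - a + 1 + 1 = n + 1 - a + 1 by omega]
    · obtain ⟨a, ha, hfa⟩ := ih h
      refine ⟨a, by omega, fun hmem => hfa ?_⟩
      have hle' : Ideal.span (x '' (T : Set ι)) ^ (n + 1 - a + 1)
          ≤ Ideal.span (x '' (T : Set ι)) ^ (n - a + 1) := Ideal.pow_le_pow_right (by omega)
      exact sup_le_sup_right hle' (Ideal.span {x i₀}) hmem

/-- The truncated Taylor expansion along the flow of `δ`, which is constant along `δ` modulo
high powers of `q`. -/
def taylorTrunc (δ : Derivation ℂ R R) (q : R) (N : ℕ) (f : R) : R :=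
  ∑ k ∈ Finset.range N, ((-1) ^ k * ((k.factorial : ℂ))⁻¹) • (q ^ k * δ^[k] f)

lemma taylorTrunc_sub_mem (δ : Derivation ℂ R R) (q : R) (N : ℕ) (f : R) :
    taylorTrunc δ q (N + 1) f - f ∈ Ideal.span {q} := by
  rw [taylorTrunc, Finset.sum_range_succ']
  simp only [pow_zero, Nat.factorial_zero, Nat.cast_one, inv_one, mul_one, one_smul, one_mul,
    Function.iterate_zero, id_eq, add_sub_cancel_right]
  refine Ideal.sum_mem _ fun k _ => ?_
  rw [Algebra.smul_def]
  refine Ideal.mul_mem_left _ _ (Ideal.mul_mem_right _ _ ?_)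
  rw [pow_succ]
  exact Ideal.mul_mem_left _ _ (Ideal.mem_span_singleton_self q)

/-- The sum telescopes: differentiating `q ^ k` in one term cancels the derivative of the iterate in
the preceding term, and only the top term is left. -/
lemma derivation_taylorTrunc (δ : Derivation ℂ R R) (q : R) (hq : δ q = 1) (N : ℕ) (f : R) :
    δ (taylorTrunc δ q (N + 1) f) ∈ Ideal.span {q ^ N} := by
  suffices h : δ (taylorTrunc δ q (N + 1) f)
      = ((-1) ^ N * ((N.factorial : ℂ))⁻¹) • (q ^ N * δ^[N + 1] f) by
    rw [h, Algebra.smul_def]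
    exact Ideal.mul_mem_left _ _ (Ideal.mul_mem_right _ _ (Ideal.mem_span_singleton_self _))
  induction N with
  | zero => simp [taylorTrunc]
  | succ N ih =>
    have h0 : ((N : ℂ) + 1) ≠ 0 := by exact_mod_cast Nat.succ_ne_zero N
    have hN : ((N + 1).factorial : ℂ)⁻¹ = ((N : ℂ) + 1)⁻¹ * (N.factorial : ℂ)⁻¹ := by
      rw [Nat.factorial_succ]; push_cast; rw [mul_inv]
    have hstep : δ (q ^ (N + 1) * δ^[N + 1] f)
        = q ^ (N + 1) * δ^[N + 1 + 1] f + ((N : ℂ) + 1) • (q ^ N * δ^[N + 1] f) := by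
      rw [Derivation.leibniz, Derivation.leibniz_pow, hq, Function.iterate_succ_apply' δ (N + 1),
        Algebra.smul_def ((N : ℂ) + 1)]
      simp only [smul_eq_mul, nsmul_eq_mul, Nat.add_sub_cancel, map_add, map_natCast, map_one,
        Nat.cast_add, Nat.cast_one]
      ring
    have hsum : taylorTrunc δ q (N + 1 + 1) f = taylorTrunc δ q (N + 1) f
        + ((-1) ^ (N + 1) * (((N + 1).factorial : ℂ))⁻¹) • (q ^ (N + 1) * δ^[N + 1] f) := by
      rw [taylorTrunc, Finset.sum_range_succ, ← taylorTrunc]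
    rw [hsum, map_add, ih, Derivation.map_smul, hstep, smul_add, smul_smul, add_left_comm,
      ← add_smul, hN]
    convert add_zero _
    convert zero_smul ℂ _
    field_simp
    ring

end DifferentialOrder

/-! ### The valuative bound, in terms of filtrations and brackets. -/

section ValuativeBound

variable {K : Type*} [Field K]

/-- The filtration `F t = {v ≥ t}` of a field by a discrete valuation `v`. -/
structure IsValuationFiltration (F : ℤ → AddSubgroup K) : Prop where
  anti : Antitone F
  mul_mem : ∀ {s t x y}, x ∈ F s → y ∈ F t → x * y ∈ F (s + t)
  mem_of_mul_mem : ∀ {a b x y}, x ∉ F (a + 1) → x * y ∈ F (a + b) → y ∈ F b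

lemma IsValuationFiltration.pow_mem {F : ℤ → AddSubgroup K}
    (hF : IsValuationFiltration F) (h1 : (1 : K) ∈ F 0) {w : ℤ} {y : K} (hy : y ∈ F w)
    (k : ℕ) : y ^ k ∈ F (k * w) := by
  induction k with
  | zero => simpa using h1
  | succ k ih =>
    rw [pow_succ]
    convert hF.mul_mem ih hy using 2
    push_cast; ring

variable {F : ℤ → AddSubgroup K}

lemma iterate_mem {C : ℤ} {D : K → K} (hC : ∀ t g, g ∈ F t → D g ∈ F (t - C)) (k : ℕ) {t : ℤ}
    {g : K} (hg : g ∈ F t) : D^[k] g ∈ F (t - k * C) := by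
  induction k with
  | zero => simpa using hg
  | succ k ih =>
    rw [Function.iterate_succ_apply']
    convert hC _ _ ih using 2
    push_cast; ring

variable {R ι : Type*} [CommRing R] [Algebra ℂ R] [Algebra ℂ K] [Algebra R K]

/-- Coordinates `x i` on a local ring `R`, with maximal ideal generated by the `x i` with `i ∈ T`,
the dual derivations, and a valuation `v` centred at `R` for which the Jacobian brackets of the
derivations lower the values by at most `A`. -/
structure IsLogAdapted [DecidableEq ι] (F : ℤ → AddSubgroup K) (A : ℤ) (T : Finset ι) (x : ι → R)
    (δ : ι → Derivation ℂ R R) (D : ι → Derivation ℂ K K) : Prop extends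
    IsValuationFiltration F where
  dual : ∀ i j, δ i (x j) = if i = j then 1 else 0
  comm : ∀ i j r, δ i (δ j r) = δ j (δ i r)
  compat : ∀ i r, D i (algebraMap R K r) = algebraMap R K (δ i r)
  mem_zero : ∀ r : R, algebraMap R K r ∈ F 0
  mem_one : ∀ i ∈ T, algebraMap R K (x i) ∈ F 1
  notMem_one : ∀ r ∉ Ideal.span (x '' T), algebraMap R K r ∉ F 1
  bracket : ∀ i j {s t g h}, g ∈ F s → h ∈ F t → D i g * D j h - D j g * D i h ∈ F (s + t - A)

variable [DecidableEq ι] {A : ℤ} {T : Finset ι} {x : ι → R}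
  {δ : ι → Derivation ℂ R R} {D : ι → Derivation ℂ K K}

namespace IsLogAdapted

/-- The bracket of `g` with the coordinate `x j` is just `D i g`, so the larger the value of a
coordinate, the cheaper the other derivations. -/
lemma derivation_mem_of_ne (h : IsLogAdapted F A T x δ D) {i j : ι} (hij : i ≠ j) {w t : ℤ}
    {g : K} (hx : algebraMap R K (x j) ∈ F w) (hg : g ∈ F t) : D i g ∈ F (t + w - A) := by
  have := h.bracket i j hg hx
  simpa [h.compat, h.dual, hij] using this

lemma algebraMap_iterate (h : IsLogAdapted F A T x δ D) (i : ι) (k : ℕ) (f : R) :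
    (D i)^[k] (algebraMap R K f) = algebraMap R K ((δ i)^[k] f) := by
  induction k with
  | zero => rfl
  | succ k ih => rw [Function.iterate_succ_apply', ih, h.compat, Function.iterate_succ_apply']

lemma smul_mem (h : IsLogAdapted F A T x δ D) {t : ℤ} (c : ℂ) {f : R}
    (hf : algebraMap R K f ∈ F t) : algebraMap R K (c • f) ∈ F t := by
  rw [Algebra.smul_def, map_mul, ← zero_add t]
  exact h.mul_mem (h.mem_zero _) hf

/-- If all the derivations lower the values by at most `β`, then an element of order at most `n`
has value at most `n β`. -/
lemma notMem_of_order_le (h : IsLogAdapted F A T x δ D) {β : ℤ} (hβ : 0 ≤ β)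
    (hcost : ∀ i ∈ T, ∀ t g, g ∈ F t → D i g ∈ F (t - β)) (n : ℕ) {f : R}
    (hf : f ∉ Ideal.span (x '' T) ^ (n + 1)) : algebraMap R K f ∉ F (n * β + 1) := by
  induction n generalizing f with
  | zero => simpa using h.notMem_one f (by simpa using hf)
  | succ n ih =>
    intro hmem
    by_cases hf' : f ∈ Ideal.span (x '' (T : Set ι)) ^ (n + 1)
    · obtain ⟨i, hi, hif⟩ := exists_derivation_notMem_pow δ x h.dual T n hf' hf
      apply ih hif
      rw [← h.compat]
      convert hcost i hi _ _ hmem using 2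
      push_cast; ring
    · refine ih hf' (h.anti ?_ hmem)
      push_cast; nlinarith

/-- Let the derivation `D i₀` lower some value by `C` exactly. Then elements which are almost
constant along `D i₀`, with restriction to `x i₀ = 0` of order at most `k`, have value at most
`k (A - C)`. -/
lemma notMem_of_restrict_order_le (h : IsLogAdapted F A T x δ D) {i₀ : ι} {w C : ℤ}
    (hw : algebraMap R K (x i₀) ∈ F w) (hCA : C ≤ A) (hC : A - C < w)
    {p : ℤ} {g₀ : K} (hg₀ : g₀ ∈ F p) (hg₀' : D i₀ g₀ ∉ F (p - C + 1)) (L k : ℕ) (hkL : k ≤ L)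
    {g : R} (hg : g ∉ Ideal.span (x '' T) ^ (k + 1) ⊔ Ideal.span {x i₀})
    (hgq : δ i₀ g ∈ Ideal.span {x i₀ ^ L}) : algebraMap R K g ∉ F (k * (A - C) + 1) := by
  induction k generalizing g with
  | zero =>
    simp only [Nat.cast_zero, zero_mul, zero_add]
    exact h.notMem_one g (fun hm => hg (Ideal.mem_sup_left (by simpa using hm)))
  | succ k ih =>
    intro hmem
    by_cases hg' : g ∈ Ideal.span (x '' (T : Set ι)) ^ (k + 1) ⊔ Ideal.span {x i₀}
    · obtain ⟨j, hj, hji, hjg⟩ := exists_derivation_notMem_pow_sup δ x h.dual T i₀ k hg' hg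
      obtain ⟨b, hb⟩ := Ideal.mem_span_singleton'.1 hgq
      refine ih (by omega) hjg ?_ ?_
      · have hzero : δ j (x i₀ ^ L) = 0 := by
          rw [Derivation.leibniz_pow, h.dual, if_neg hji, smul_zero, smul_zero]
        rw [h.comm, ← hb, Derivation.leibniz, hzero, smul_zero, zero_add, smul_eq_mul]
        exact Ideal.mul_mem_right _ _ (Ideal.mem_span_singleton_self _)
      · set t : ℤ := ((k + 1 : ℕ) : ℤ) * (A - C) + 1 with ht
        -- Test `g` against `g₀`, on which `D i₀` attains its cost. The product `D i₀ g₀ * D j g` is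
        -- the bracket plus an error with the factor `D i₀ g`. Dividing by `D i₀ g₀`, of value at
        -- most `p - C`, leaves a loss of only `A - C`.
        have h1 := h.bracket i₀ j hg₀ hmem
        have h2 : D j g₀ ∈ F (p + w - A) := h.derivation_mem_of_ne hji hw hg₀
        have h3 : D i₀ (algebraMap R K g) ∈ F (L * w) := by
          rw [h.compat, ← hb, map_mul, map_pow, ← zero_add ((L : ℤ) * w)]
          refine h.mul_mem (h.mem_zero b) (h.pow_mem ?_ hw L)
          simpa using h.mem_zero 1
        -- The error is negligible because the exponent `L` is at least the order involved and `A -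
        -- C < w`.
        have htL : t ≤ w + L * w := by
          have : ((k + 1 : ℕ) : ℤ) * (A - C) ≤ L * (A - C) := by
            apply mul_le_mul_of_nonneg_right (by exact_mod_cast hkL) (by omega)
          have : (L : ℤ) * (A - C) ≤ L * w := by
            apply mul_le_mul_of_nonneg_left hC.le (by positivity)
          omega
        have h4 : D j g₀ * D i₀ (algebraMap R K g) ∈ F (p + t - A) :=
          h.anti (by linarith) (h.mul_mem h2 h3)
        have h5 : D i₀ g₀ * D j (algebraMap R K g) ∈ F ((p - C) + (k * (A - C) + 1)) := by
          have := add_mem h1 h4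
          rw [sub_add_cancel] at this
          convert this using 2
          rw [ht]; push_cast; ring
        rw [← h.compat]
        exact h.mem_of_mul_mem hg₀' h5
    · refine ih (by omega) hg' hgq (h.anti ?_ hmem)
      push_cast
      nlinarith

lemma taylorTrunc_mem (h : IsLogAdapted F A T x δ D) (i₀ : ι) {B : ℤ} (N : ℕ) (f : R)
    (hf : ∀ k < N, algebraMap R K (x i₀ ^ k * (δ i₀)^[k] f) ∈ F B) :
    algebraMap R K (taylorTrunc (δ i₀) (x i₀) N f) ∈ F B := by
  rw [taylorTrunc, map_sum]
  exact sum_mem fun k hk => h.smul_mem _ (hf k (Finset.mem_range.1 hk))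

/-- The least amount by which the derivation `D i₀` may lower the values. -/
lemma exists_sharp_cost (h : IsLogAdapted F A T x δ D) {i₀ j₀ : ι} (hj₀ : j₀ ∈ T) (hij : i₀ ≠ j₀)
    {w : ℤ} (hw : algebraMap R K (x i₀) ∈ F w) (h1 : (1 : K) ∉ F 1) :
    ∃ C : ℤ, w ≤ C ∧ C < A ∧ (∀ t g, g ∈ F t → D i₀ g ∈ F (t - C)) ∧
      ∃ p g, g ∈ F p ∧ D i₀ g ∉ F (p - C + 1) := by
  -- Lower bound for the cost: `D i₀` sends `x i₀`, of value at least `w`, to 1.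
  have hbd : ∀ C : ℤ, (∀ t g, g ∈ F t → D i₀ g ∈ F (t - C)) → w ≤ C := by
    intro C hC
    by_contra! hlt
    refine h1 (h.anti (show (1 : ℤ) ≤ w - C by omega) ?_)
    simpa [h.compat, h.dual] using hC w _ hw
  -- Upper bound: bracket with the second parameter `x j₀`, whose value is at least 1.
  have hA : ∀ t g, g ∈ F t → D i₀ g ∈ F (t - (A - 1)) := by
    intro t g hg
    convert h.derivation_mem_of_ne hij (h.mem_one j₀ hj₀) hg using 2
    ring
  obtain ⟨C, hC, hmin⟩ := Int.exists_least_of_bdd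
    (P := fun C => ∀ t g, g ∈ F t → D i₀ g ∈ F (t - C)) ⟨w, hbd⟩ ⟨A - 1, hA⟩
  refine ⟨C, hbd C hC, by have := hmin _ hA; omega, hC, ?_⟩
  by_contra! hcon
  have := hmin (C - 1) (fun t g hg => by
    have := hcon t g hg
    convert this using 2; ring)
  omega

/-- If the order of `f` is at most `n`, and the order of the restriction of `f` to the hypersurface
`x i₀ = 0` is at most `2 n - c`, where `c ≤ n`, then the pair `(f ^ (1 / n), x i₀ ^ (c / n))` is log
canonical with respect to the valuation. -/
theorem add_mul_le (h : IsLogAdapted F A T x δ D) {i₀ j₀ : ι} (hi₀ : i₀ ∈ T) (hj₀ : j₀ ∈ T)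
    (hij : i₀ ≠ j₀) {w : ℤ} (hw0 : 0 < w) (hw : algebraMap R K (x i₀) ∈ F w)
    (h1 : (1 : K) ∉ F 1) (n M : ℕ) (c : ℤ) (hcn : c ≤ n) (hM : (M : ℤ) ≤ 2 * n - c) {f : R}
    (hf : f ∉ Ideal.span (x '' T) ^ (n + 1))
    (hfq : f ∉ Ideal.span (x '' T) ^ (M + 1) ⊔ Ideal.span {x i₀}) {s : ℤ}
    (hs : algebraMap R K f ∈ F s) : s + c * w ≤ n * A := by
  obtain ⟨C, hwC, hCA, hC, p, g₀, hg₀, hg₀'⟩ := h.exists_sharp_cost hj₀ hij hw h1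
  have hone : (1 : K) ∈ F 0 := by simpa using h.mem_zero 1
  have hother : ∀ i, i ≠ i₀ → ∀ t g, g ∈ F t → D i g ∈ F (t - (A - w)) := by
    intro i hi t g hg
    convert h.derivation_mem_of_ne hi hw hg using 2
    ring
  have hn0 : (0 : ℤ) ≤ n := by positivity
  -- For `c ≤ 0` the crude cost `A` for all derivations already suffices.
  rcases le_or_gt c 0 with hc0 | hc0
  · have := h.notMem_of_order_le (β := A) (by omega) (fun i _ t g hg => by
      by_cases hi : i = i₀
      · subst hi; exact h.anti (by omega) (hC t g hg)
      · exact h.anti (by omega) (hother i hi t g hg)) n hf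
    have hlt : s < n * A + 1 := by
      by_contra! hle
      exact this (h.anti hle hs)
    nlinarith
  -- If `w ≤ A - C`, the transversal derivation is as cheap as the tangential ones, and `s ≤ n (A -
  -- w)`.
  rcases le_or_gt w (A - C) with hcase | hcase
  · have := h.notMem_of_order_le (β := A - w) (by omega) (fun i _ t g hg => by
      by_cases hi : i = i₀
      · subst hi; exact h.anti (by omega) (hC t g hg)
      · exact hother i hi t g hg) n hf
    have hlt : s < n * (A - w) + 1 := by
      by_contra! hle
      exact this (h.anti hle hs)
    nlinarith
  -- Otherwise every Taylor term `x i₀ ^ k * δ^k f` would have value above the minimum: for `k ≤ n`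
  -- by assumption, for `k > n` because of the power of `x i₀`, whence the entry `n * w` in the
  -- minimum.
  · have key : ∃ i ≤ n, algebraMap R K ((δ i₀)^[i] f)
        ∉ F (min (M * (A - C)) (n * w) - i * w + 1) := by
      by_contra! hcon
      have hqk : ∀ k : ℕ, algebraMap R K (x i₀ ^ k) ∈ F (k * w) := fun k => by
        rw [map_pow]; exact h.pow_mem hone hw k
      have hbig : ∀ k : ℕ, ∀ r : R, algebraMap R K (x i₀ ^ k * r) ∈ F (k * w) := fun k r => by
        rw [map_mul, ← add_zero ((k : ℤ) * w)]; exact h.mul_mem (hqk k) (h.mem_zero r)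
      have hder : δ i₀ (x i₀) = 1 := by simp [h.dual]
      rcases le_total ((M : ℤ) * (A - C)) (n * w) with hB | hB
      -- The Taylor expansion of `f` has the same restriction as `f`, of order at most `M`, but too
      -- large a value.
      · rw [min_eq_left hB] at hcon
        refine h.notMem_of_restrict_order_le hw hCA.le hcase hg₀ hg₀' M M le_rfl
          (g := taylorTrunc (δ i₀) (x i₀) (M + 1) f) ?_ (derivation_taylorTrunc _ _ hder _ _) ?_
        · intro hmem
          refine hfq ?_
          have := Ideal.sub_mem _ hmem (Ideal.mem_sup_right
            (taylorTrunc_sub_mem (δ i₀) (x i₀) M f))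
          rwa [sub_sub_cancel] at this
        · refine h.taylorTrunc_mem i₀ _ _ fun k _ => ?_
          rcases le_or_gt k n with hk | hk
          · rw [map_mul]
            convert h.mul_mem (hqk k) (hcon k hk) using 2
            ring
          · refine h.anti ?_ (hbig k _)
            have : ((n : ℤ) + 1) * w ≤ k * w := by
              apply mul_le_mul_of_nonneg_right (by exact_mod_cast hk) hw0.le
            linarith
      · rw [min_eq_right hB] at hcon
        -- The order of `f` itself is used here: expand a transversal derivative whose restriction
        -- has order at most `n - a`. Its value may be at most `(n - a) (A - C)`, which does not
        -- exceed `(n - a) w`.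
        obtain ⟨a, ha, hfa⟩ :=
          exists_iterate_derivation_notMem δ x h.dual h.comm T i₀ hi₀ n hf
        refine h.notMem_of_restrict_order_le hw hCA.le hcase hg₀ hg₀' n (n - a)
          (Nat.sub_le _ _) (g := taylorTrunc (δ i₀) (x i₀) (n + 1) ((δ i₀)^[a] f)) ?_
          (derivation_taylorTrunc _ _ hder _ _) ?_
        · intro hmem
          refine hfa ?_
          have := Ideal.sub_mem _ hmem (Ideal.mem_sup_right
            (taylorTrunc_sub_mem (δ i₀) (x i₀) n ((δ i₀)^[a] f)))
          rwa [sub_sub_cancel] at this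
        · have hna : ((n - a : ℕ) : ℤ) = n - a := by push_cast [ha]; ring
          have hle : ((n - a : ℕ) : ℤ) * (A - C) ≤ (n - a) * w := by
            rw [hna]; apply mul_le_mul_of_nonneg_left hcase.le (by omega)
          refine h.anti (show _ ≤ ((n : ℤ) - a) * w + 1 by linarith)
            (h.taylorTrunc_mem i₀ _ _ fun k _ => ?_)
          rw [← Function.iterate_add_apply]
          rcases le_or_gt (k + a) n with hk | hk
          · rw [map_mul]
            convert h.mul_mem (hqk k) (hcon (k + a) hk) using 2
            push_cast; ring
          · refine h.anti ?_ (hbig k _)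
            have : ((n : ℤ) - a + 1) * w ≤ k * w := by
              apply mul_le_mul_of_nonneg_right _ hw0.le
              omega
            linarith
    obtain ⟨i, hin, hi⟩ := key
    -- Applying `D i₀` `i` times costs at most `i C`, so `s ≤ M (A - C) + i (C - w)`. With `i ≤ n`
    -- and `M ≤ 2 n - c` the right side is at most `n A - c w - (n - c) (w - (A - C))`.
    have hmem := iterate_mem hC i hs
    rw [h.algebraMap_iterate] at hmem
    have hlt : s - i * C < min ((M : ℤ) * (A - C)) (n * w) - i * w + 1 := by
      by_contra! hle
      exact hi (h.anti hle hmem)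
    have hmin : min ((M : ℤ) * (A - C)) (n * w) ≤ M * (A - C) := min_le_left _ _
    have e1 : (i : ℤ) * (C - w) ≤ n * (C - w) :=
      mul_le_mul_of_nonneg_right (by exact_mod_cast hin) (by omega)
    have e2 : (M : ℤ) * (A - C) ≤ (2 * n - c) * (A - C) :=
      mul_le_mul_of_nonneg_right hM (by omega)
    have e3 : 0 ≤ ((n : ℤ) - c) * (w - (A - C)) := mul_nonneg (by omega) (by omega)
    nlinarith

end IsLogAdapted

end ValuativeBound

/-! ### Coordinates on regular local rings essentially of finite type. -/

section Coordinates

open scoped IntermediateField.algebraAdjoinAdjoin in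
/-- In characteristic zero the differentials of some transcendence basis form a basis of the
differentials. -/
lemma exists_algebraicIndependent_basis_kaehlerDifferential (k L : Type*) [Field k] [CharZero k]
    [Field L] [Algebra k L] [Algebra.EssFiniteType k L] :
    ∃ (s : Finset L) (b : Module.Basis s L Ω[L⁄k]),
      IsTranscendenceBasis k ((↑) : s → L) ∧ ∀ i, b i = KaehlerDifferential.D k L i := by
  obtain ⟨s, hs, hsep⟩ := exists_isTranscendenceBasis_and_isSeparable_of_perfectField k L
  have hind : AlgebraicIndependent k ((↑) : s → L) := hs.1
  have hr : Set.range ((↑) : s → L) = (s : Set L) := by simp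
  let P := MvPolynomial s k
  let B := Algebra.adjoin k (Set.range ((↑) : s → L))
  let F := IntermediateField.adjoin k (Set.range ((↑) : s → L))
  have hsep' : Algebra.IsSeparable F L := by
    convert hsep
  let e : P ≃ₐ[k] B := hind.aevalEquiv
  let _ : Algebra P B := e.toRingEquiv.toRingHom.toAlgebra
  let _ : Algebra P F := ((algebraMap B F).comp (algebraMap P B)).toAlgebra
  let _ : Algebra P L := ((algebraMap B L).comp (algebraMap P B)).toAlgebra
  have _ : IsScalarTower P B F := .of_algebraMap_eq (fun _ => rfl)
  have _ : IsScalarTower P B L := .of_algebraMap_eq (fun _ => rfl)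
  have _ : IsScalarTower P F L := .of_algebraMap_eq (fun _ => rfl)
  have _ : IsScalarTower k P L := .of_algebraMap_eq (fun x => by
    change _ = algebraMap B L (e (algebraMap k P x))
    rw [e.commutes]; rfl)
  -- The extension is étale over the polynomial ring in the transcendence basis: an isomorphism, a
  -- localization and a separable algebraic extension. Hence the differentials of the variables
  -- remain a basis after base change.
  have h1 : Algebra.FormallyEtale P B :=
    .of_equiv (A := P) (AlgEquiv.ofBijective (Algebra.ofId P B) e.bijective)
  have h2 : Algebra.FormallyEtale B F := .of_isLocalization (nonZeroDivisors _)
  have h3 : Algebra.FormallyEtale F L := .of_isSeparable _ _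
  have h4 : Algebra.FormallyEtale P F := .comp P B F
  have h5 : Algebra.FormallyEtale P L := .comp P F L
  let b₀ := KaehlerDifferential.mvPolynomialBasis k s
  let b := (b₀.baseChange L).map (KaehlerDifferential.tensorKaehlerEquivOfFormallyEtale k P L)
  refine ⟨s, b, hs, fun i => ?_⟩
  have : b₀ i = KaehlerDifferential.D k P (MvPolynomial.X i) :=
    KaehlerDifferential.mvPolynomialBasis_apply k s i
  rw [Module.Basis.map_apply, Module.Basis.baseChange_apply, this,
    ← KaehlerDifferential.tensorKaehlerEquivOfFormallyEtale_symm_D_algebraMap,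
    LinearEquiv.apply_symm_apply]
  congr 1
  change algebraMap B L (e (MvPolynomial.X i)) = _
  change ((hind.aevalEquiv (MvPolynomial.X i) : B) : L) = _
  simp

section Independence

variable {k R : Type*} [Field k] [CommRing R] [Algebra k R]

/-- The residue classes of the `z i` modulo the ideal `P` are algebraically independent. -/
def IndepMod (k : Type*) {R ι : Type*} [Field k] [CommRing R] [Algebra k R] (P : Ideal R)
    (z : ι → R) : Prop :=
  ∀ F : MvPolynomial ι k, MvPolynomial.aeval z F ∈ P → F = 0

/-- In a relation modulo `P'`, viewed as a polynomial in `p`, the constant coefficient vanishes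
already modulo `P`. The remainder is divisible by `p`, which cancels because `P'` is prime and `p ∉
P'`; induct on the degree. -/
lemma IndepMod.option {ι : Type*} {P P' : Ideal R} [P'.IsPrime] (hle : P' ≤ P)
    {z : ι → R} (hz : IndepMod k P z) {p : R} (hp : p ∈ P) (hp' : p ∉ P') :
    IndepMod k P' (fun o : Option ι => o.elim p z) := by
  intro G hG
  have key : ∀ (n : ℕ) (H : Polynomial (MvPolynomial ι k)), H.natDegree ≤ n →
      Polynomial.eval₂ (MvPolynomial.aeval (R := k) z).toRingHom p H ∈ P' → H = 0 := by
    intro n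
    induction n with
    | zero =>
      intro H hH hmem
      rw [Polynomial.eq_C_of_natDegree_le_zero hH] at hmem ⊢
      rw [Polynomial.eval₂_C] at hmem
      rw [hz _ (hle hmem), map_zero]
    | succ n ih =>
      intro H hH hmem
      have h0 : H.coeff 0 = 0 := by
        refine hz _ ?_
        have := hle hmem
        rw [← H.divX_mul_X_add, Polynomial.eval₂_add, Polynomial.eval₂_mul, Polynomial.eval₂_X,
          Polynomial.eval₂_C] at this
        exact (Ideal.add_mem_iff_right _ (Ideal.mul_mem_left _ _ hp)).1 this
      have hdiv := H.divX_mul_X_add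
      rw [h0, map_zero, add_zero] at hdiv
      have h1 : H.divX = 0 := by
        refine ih _ ?_ ?_
        · rw [Polynomial.natDegree_divX_eq_natDegree_tsub_one]; omega
        · rw [← hdiv, Polynomial.eval₂_mul, Polynomial.eval₂_X] at hmem
          exact (Ideal.IsPrime.mem_or_mem ‹_› hmem).resolve_right hp'
      rw [← hdiv, h1, zero_mul]
  have heval : ∀ G : MvPolynomial (Option ι) k,
      Polynomial.eval₂ (MvPolynomial.aeval (R := k) z).toRingHom p
        (MvPolynomial.optionEquivLeft k ι G)
        = MvPolynomial.aeval (fun o : Option ι => o.elim p z) G := by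
    intro G
    induction G using MvPolynomial.induction_on with
    | C a => simp [MvPolynomial.optionEquivLeft_C]
    | add a b ha hb => rw [map_add, Polynomial.eval₂_add, ha, hb, map_add]
    | mul_X a i ha =>
      rw [map_mul, Polynomial.eval₂_mul, ha, map_mul]
      cases i <;> simp
  have h1 := key _ (MvPolynomial.optionEquivLeft k ι G) le_rfl (by rw [heval]; exact hG)
  simpa using h1

/-- The dimension inequality: along a chain of primes, the number of algebraically independent
elements grows. -/
lemma exists_indepMod_of_ltSeries (l : LTSeries (PrimeSpectrum R)) {ι : Type} [Fintype ι]
    {z : ι → R} (hz : IndepMod k l.last.asIdeal z) :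
    ∃ (ι' : Type) (_ : Fintype ι') (z' : ι' → R), Fintype.card ι' = Fintype.card ι + l.length ∧
      IndepMod k l.head.asIdeal z' := by
  have : ∀ i (hi : i ≤ l.length), ∃ (ι' : Type) (_ : Fintype ι') (z' : ι' → R),
      Fintype.card ι' = Fintype.card ι + i ∧
      IndepMod k (l ⟨l.length - i, by omega⟩).asIdeal z' := by
    intro i
    induction i with
    | zero => intro _; exact ⟨ι, ‹_›, z, by simp, hz⟩
    | succ i ih =>
      intro hi
      obtain ⟨ι', _, z', hc, hz'⟩ := ih (by omega)
      have hlt : l ⟨l.length - (i + 1), by omega⟩ < l ⟨l.length - i, by omega⟩ :=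
        l.strictMono (by simp only [Fin.mk_lt_mk]; omega)
      obtain ⟨p, hp, hp'⟩ := SetLike.exists_of_lt
        (show (l ⟨l.length - (i + 1), by omega⟩).asIdeal < (l ⟨l.length - i, by omega⟩).asIdeal
          from hlt)
      exact ⟨Option ι', inferInstance, _, by simp [hc]; omega, hz'.option hlt.le hp hp'⟩
  obtain ⟨ι', h, z', hc, hz'⟩ := this l.length le_rfl
  refine ⟨ι', h, z', hc, ?_⟩
  convert hz'
  simp [RelSeries.head]

end Independence

lemma IndepMod.mono {k R ι : Type*} [Field k] [CommRing R] [Algebra k R] {P P' : Ideal R}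
    (hle : P' ≤ P) {z : ι → R} (hz : IndepMod k P z) : IndepMod k P' z :=
  fun F hF => hz F (hle hF)

section LocalRing

variable {R K : Type*} [CommRing R] [IsLocalRing R] [Algebra ℂ R]
  [Algebra.EssFiniteType ℂ R] [Field K] [Algebra R K] [IsFractionRing R K] [Algebra ℂ K]
  [IsScalarTower ℂ R K]

/-- The differentials of generators of the maximal ideal together with those of lifts of a
transcendence basis of the residue field generate the differentials of a local ring. -/
lemma span_D_eq_top {ι ι' : Type*} [Finite ι'] (y : ι → R)
    (hy : Ideal.span (Set.range y) = maximalIdeal R) (z : ι' → R)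
    (b : Module.Basis ι' (ResidueField R) Ω[ResidueField R⁄ℂ])
    (hb : ∀ i, b i = KaehlerDifferential.D ℂ _ (residue R (z i))) :
    Submodule.span R (Set.range fun i => KaehlerDifferential.D ℂ R (Sum.elim y z i)) = ⊤ := by
  have := Fintype.ofFinite ι'
  set N := Submodule.span R (Set.range fun i => KaehlerDifferential.D ℂ R (Sum.elim y z i)) with hN
  have hy' : ∀ i, KaehlerDifferential.D ℂ R (y i) ∈ N := fun i => Submodule.subset_span ⟨.inl i, rfl⟩
  have hz' : ∀ i, KaehlerDifferential.D ℂ R (z i) ∈ N := fun i => Submodule.subset_span ⟨.inr i, rfl⟩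
  have hm : ∀ a ∈ maximalIdeal R, KaehlerDifferential.D ℂ R a ∈
      N ⊔ maximalIdeal R • (⊤ : Submodule R Ω[R⁄ℂ]) := by
    intro a ha
    rw [← hy] at ha
    refine Submodule.span_induction ?_ (by simp) ?_ ?_ ha
    · rintro _ ⟨i, rfl⟩; exact Submodule.mem_sup_left (hy' i)
    · intro a b _ _ h1 h2; rw [map_add]; exact add_mem h1 h2
    · intro c a ha h1
      replace ha : a ∈ maximalIdeal R := hy ▸ ha
      rw [smul_eq_mul, Derivation.leibniz]
      exact add_mem (Submodule.smul_mem _ _ h1)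
        (Submodule.mem_sup_right (Submodule.smul_mem_smul ha trivial))
  -- Nakayama: it is enough to generate modulo the maximal ideal.
  refine top_le_iff.1 (Submodule.le_of_le_smul_of_le_jacobson_bot
    (Module.Finite.fg_top) (IsLocalRing.maximalIdeal_le_jacobson ⊥) ?_)
  rw [← KaehlerDifferential.span_range_derivation, Submodule.span_le]
  rintro _ ⟨a, rfl⟩
  rw [KaehlerDifferential.span_range_derivation]
  choose c hc using fun i => residue_surjective (R := R)
    (b.repr (KaehlerDifferential.D ℂ _ (residue R a)) i)
  -- After subtracting the contribution of the `z i`, the differential dies over the residue field.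
  -- By the conormal sequence it is then, modulo the maximal ideal, the differential of an element
  -- of that ideal.
  have hker : KaehlerDifferential.map ℂ ℂ R (ResidueField R)
      (KaehlerDifferential.D ℂ R a - ∑ i, c i • KaehlerDifferential.D ℂ R (z i)) = 0 := by
    rw [map_sub, map_sum, KaehlerDifferential.map_D, sub_eq_zero]
    refine (b.sum_repr _).symm.trans (Finset.sum_congr rfl fun i _ => ?_)
    rw [map_smul, KaehlerDifferential.map_D, hb]
    rw [ResidueField.algebraMap_eq, ← hc, ← ResidueField.algebraMap_eq, algebraMap_smul]
  rw [← LinearMap.mem_ker] at hker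
  rw [← sub_add_cancel (KaehlerDifferential.D ℂ R a) (∑ i, c i • KaehlerDifferential.D ℂ R (z i))]
  refine add_mem ?_ (Submodule.mem_sup_left (sum_mem fun i _ => Submodule.smul_mem _ _ (hz' i)))
  set ω := KaehlerDifferential.D ℂ R a - ∑ i, c i • KaehlerDifferential.D ℂ R (z i)
  have h1 : (1 : ResidueField R) ⊗ₜ[R] ω ∈
      (LinearMap.ker (KaehlerDifferential.mapBaseChange ℂ R (ResidueField R))).restrictScalars R := by
    rw [Submodule.restrictScalars_mem, LinearMap.mem_ker, KaehlerDifferential.mapBaseChange_tmul,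
      one_smul]
    exact hker
  rw [← KaehlerDifferential.range_kerCotangentToTensor ℂ R _ residue_surjective] at h1
  obtain ⟨w, hw⟩ := h1
  obtain ⟨w, rfl⟩ := Ideal.toCotangent_surjective _ w
  rw [KaehlerDifferential.kerCotangentToTensor_toCotangent] at hw
  have hwm : (w : R) ∈ maximalIdeal R := by
    exact (residue_eq_zero_iff _).1 (RingHom.mem_ker.1 w.2)
  have h2 : ω - KaehlerDifferential.D ℂ R (w : R) ∈
      maximalIdeal R • (⊤ : Submodule R Ω[R⁄ℂ]) := by
    have : (1 : R ⧸ maximalIdeal R) ⊗ₜ[R] (ω - KaehlerDifferential.D ℂ R (w : R)) = 0 := by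
      rw [TensorProduct.tmul_sub, sub_eq_zero]; exact hw.symm
    rw [← LinearMap.ker_tensorProductMk]
    exact this
  rw [← sub_add_cancel ω (KaehlerDifferential.D ℂ R (w : R))]
  exact add_mem (Submodule.mem_sup_right h2) (hm _ hwm)

/-- Regular local rings essentially of finite type over `ℂ` have coordinates. -/
theorem exists_coordinates {d r : ℕ} (hd : Module.finrank K Ω[K⁄ℂ] = d) (y : Fin r → R)
    (hy : Ideal.span (Set.range y) = maximalIdeal R) (hr : (r : WithBot ℕ∞) ≤ ringKrullDim R) :
    ∃ (x : Fin d → R) (e : Fin r → Fin d) (b : Module.Basis (Fin d) K Ω[K⁄ℂ]),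
      Function.Injective e ∧ (∀ i, x (e i) = y i) ∧
      (∀ j, b j = KaehlerDifferential.D ℂ K (algebraMap R K (x j))) ∧
      ∀ a : R, KaehlerDifferential.D ℂ K (algebraMap R K a) ∈ Submodule.span R (Set.range b) := by
  have hess : Algebra.EssFiniteType R K := .of_isLocalization K (nonZeroDivisors R)
  have hessK : Algebra.EssFiniteType ℂ K := .comp ℂ R K
  have hessκ : Algebra.EssFiniteType ℂ (ResidueField R) :=
    inferInstanceAs (Algebra.EssFiniteType ℂ (R ⧸ maximalIdeal R))
  obtain ⟨s, b, hs, hb⟩ := exists_algebraicIndependent_basis_kaehlerDifferential ℂ (ResidueField R)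
  obtain ⟨t, bK, ht, hbK⟩ := exists_algebraicIndependent_basis_kaehlerDifferential ℂ K
  choose z hz using fun i : s => residue_surjective (R := R) (i : ResidueField R)
  have htop := span_D_eq_top y hy z b (fun i => by rw [hb, hz])
  have hmem : ∀ a : R, KaehlerDifferential.D ℂ K (algebraMap R K a) ∈ Submodule.span R
      (Set.range fun i => KaehlerDifferential.D ℂ K (algebraMap R K (Sum.elim y z i))) := by
    intro a
    have h1 : KaehlerDifferential.D ℂ R a ∈ Submodule.span R
        (Set.range fun i => KaehlerDifferential.D ℂ R (Sum.elim y z i)) := htop ▸ trivial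
    have h2 := Submodule.mem_map_of_mem (f := KaehlerDifferential.map ℂ ℂ R K) h1
    rw [Submodule.map_span, KaehlerDifferential.map_D, ← Set.range_comp] at h2
    convert h2 using 4
    simp
  have hKtop : Submodule.span K (Set.range fun i =>
      KaehlerDifferential.D ℂ K (algebraMap R K (Sum.elim y z i))) = ⊤ := by
    rw [← top_le_iff, ← KaehlerDifferential.span_range_map_derivation_of_isLocalization ℂ R K
      (nonZeroDivisors R), Submodule.span_le]
    rintro _ ⟨a, rfl⟩
    have h1 := hmem a
    simp only [Function.comp_apply, KaehlerDifferential.map_D]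
    exact Submodule.span_le_restrictScalars R K _ h1
  have htd : t.card = d := by
    rw [← hd, Module.finrank_eq_card_basis bK, Fintype.card_coe]
  have hcard : r + s.card ≤ d := by
    -- Going down a chain of `r` primes from the closed point adds `r` independent elements to the
    -- lifts of the transcendence basis of the residue field; their number is bounded by the
    -- transcendence degree of `K`, which is `d`.
    obtain ⟨l, hl⟩ := Order.le_krullDim_iff.1 hr
    have hz0 : IndepMod ℂ l.last.asIdeal (fun i => z (s.equivFin.symm i)) := by
      refine IndepMod.mono (le_maximalIdeal l.last.isPrime.ne_top) fun G hG => ?_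
      have hG' : MvPolynomial.aeval
          (fun i => ((s.equivFin.symm i : s) : ResidueField R)) G = 0 := by
        have h1 := (residue_eq_zero_iff _).2 hG
        have h2 := MvPolynomial.comp_aeval_apply (fun i => z (s.equivFin.symm i))
          (IsScalarTower.toAlgHom ℂ R (ResidueField R)) G
        simp only [IsScalarTower.coe_toAlgHom', ResidueField.algebraMap_eq, hz] at h2
        rw [← h2]; exact h1
      have := (hs.1.comp _ s.equivFin.symm.injective)
      rw [algebraicIndependent_iff] at this
      exact this G hG'
    obtain ⟨ι', _, z', hc, hz'⟩ := exists_indepMod_of_ltSeries l hz0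
    have hind : AlgebraicIndependent ℂ (fun i => algebraMap R K (z' i)) := by
      rw [algebraicIndependent_iff]
      intro G hG
      refine hz' G ?_
      have h2 := MvPolynomial.comp_aeval_apply z' (IsScalarTower.toAlgHom ℂ R K) G
      simp only [IsScalarTower.coe_toAlgHom'] at h2
      rw [← h2, FaithfulSMul.algebraMap_eq_zero_iff] at hG
      rw [hG]; exact Ideal.zero_mem _
    have h1 := hind.lift_cardinalMk_le_trdeg
    rw [← ht.cardinalMk_eq_trdeg] at h1
    simp only [Cardinal.mk_fintype, Cardinal.lift_natCast, Fintype.card_coe, Nat.cast_le] at h1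
    rw [htd, hc, Fintype.card_fin, hl] at h1
    omega
  -- Conversely the `r + s.card` differentials span a space of dimension `d`; the two bounds make
  -- them a basis.
  have hcard' : d ≤ r + s.card := by
    rw [← hd, ← finrank_top, ← hKtop]
    refine (finrank_range_le_card _).trans ?_
    simp
  have e₀ : Fin d ≃ Fin r ⊕ s := Fintype.equivOfCardEq (by simp; omega)
  let bs : Module.Basis (Fin r ⊕ s) K Ω[K⁄ℂ] := basisOfTopLeSpanOfCardEqFinrank _ hKtop.ge
    (by rw [hd, Fintype.card_sum, Fintype.card_fin, Fintype.card_coe]; omega)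
  refine ⟨fun j => Sum.elim y z (e₀ j), fun i => e₀.symm (.inl i), bs.reindex e₀.symm, ?_, ?_, ?_,
    ?_⟩
  · intro i j h; simpa using h
  · intro i; simp
  · intro j; simp [bs]
  · intro a
    have := hmem a
    convert this using 2
    rw [Module.Basis.coe_reindex, Equiv.symm_symm, e₀.surjective.range_comp]
    simp [bs]

end LocalRing

end Coordinates

/-! ### Derivations dual to coordinates. -/

section DualDerivations

variable {R K ι : Type*} [CommRing R] [Algebra ℂ R] [Field K] [Algebra R K] [Algebra ℂ K]
  [IsScalarTower ℂ R K]

/-- The derivations of `K` dual to a basis of differentials. -/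
def coordDerivation (b : Module.Basis ι K Ω[K⁄ℂ]) (i : ι) : Derivation ℂ K K :=
  (b.coord i).compDer (KaehlerDifferential.D ℂ K)

lemma coordDerivation_apply (b : Module.Basis ι K Ω[K⁄ℂ]) (i : ι) (g : K) :
    coordDerivation b i g = b.repr (KaehlerDifferential.D ℂ K g) i := rfl

lemma sum_coordDerivation [Fintype ι] (b : Module.Basis ι K Ω[K⁄ℂ]) (g : K) :
    ∑ i, coordDerivation b i g • b i = KaehlerDifferential.D ℂ K g := by
  simp only [coordDerivation_apply]
  exact b.sum_repr _

/-- The commutator is a derivation, and it kills every `x k` since the mutual derivatives are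
constants; so it vanishes on a basis of the differentials. -/
lemma coordDerivation_comm [DecidableEq ι] (b : Module.Basis ι K Ω[K⁄ℂ]) (x : ι → K)
    (hb : ∀ i, b i = KaehlerDifferential.D ℂ K (x i)) (i j : ι) (g : K) :
    coordDerivation b i (coordDerivation b j g) = coordDerivation b j (coordDerivation b i g) := by
  have hx : ∀ i k, coordDerivation b i (x k) = if k = i then 1 else 0 := by
    intro i k
    rw [coordDerivation_apply, ← hb, Module.Basis.repr_self, Finsupp.single_apply]
  set E := ⁅coordDerivation b i, coordDerivation b j⁆ with hE
  have h0 : E.liftKaehlerDifferential = 0 := by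
    refine b.ext fun k => ?_
    rw [hb, Derivation.liftKaehlerDifferential_comp_D, hE, Derivation.commutator_apply, hx, hx]
    split_ifs <;> simp
  have : E g = 0 := by
    rw [← Derivation.liftKaehlerDifferential_comp_D, h0, LinearMap.zero_apply]
  rwa [hE, Derivation.commutator_apply, sub_eq_zero] at this

lemma exists_restrict_derivation [FaithfulSMul R K] (D : Derivation ℂ K K)
    (hD : ∀ a : R, D (algebraMap R K a) ∈ (algebraMap R K).range) :
    ∃ δ : Derivation ℂ R R, ∀ a, D (algebraMap R K a) = algebraMap R K (δ a) := by
  choose f hf using hD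
  have hinj : Function.Injective (algebraMap R K) := FaithfulSMul.algebraMap_injective R K
  refine ⟨Derivation.mk' ⟨⟨f, fun a b => hinj ?_⟩, fun c a => hinj ?_⟩ fun a b => hinj ?_,
    fun a => (hf a).symm⟩
  · simp [hf]
  · simp only [RingHom.id_apply]
    have h : ∀ r : R, algebraMap R K (c • r) = c • algebraMap R K r :=
      (IsScalarTower.toAlgHom ℂ R K).toLinearMap.map_smul c
    rw [hf, h, h, hf, Derivation.map_smul]
  · simp [hf]

/-- Coordinates on `R` have dual derivations. -/
theorem exists_dual_derivations [FaithfulSMul R K] [Fintype ι] [DecidableEq ι] {x : ι → R}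
    (b : Module.Basis ι K Ω[K⁄ℂ])
    (hb : ∀ j, b j = KaehlerDifferential.D ℂ K (algebraMap R K (x j)))
    (hR : ∀ a : R, KaehlerDifferential.D ℂ K (algebraMap R K a) ∈
      Submodule.span R (Set.range b)) :
    ∃ δ : ι → Derivation ℂ R R, (∀ i j, δ i (x j) = if i = j then 1 else 0) ∧
      (∀ i j r, δ i (δ j r) = δ j (δ i r)) ∧
      ∀ i r, coordDerivation b i (algebraMap R K r) = algebraMap R K (δ i r) := by
  have hinj : Function.Injective (algebraMap R K) := FaithfulSMul.algebraMap_injective R K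
  have h : ∀ i, ∃ δ : Derivation ℂ R R,
      ∀ a, coordDerivation b i (algebraMap R K a) = algebraMap R K (δ a) := by
    intro i
    refine exists_restrict_derivation _ fun a => ?_
    obtain ⟨c, hc⟩ := (Submodule.mem_span_range_iff_exists_fun R).1 (hR a)
    refine ⟨c i, ?_⟩
    have hs : ∑ k, c k • b k = ∑ k, algebraMap R K (c k) • b k :=
      Finset.sum_congr rfl fun k _ => (algebraMap_smul K _ _).symm
    rw [coordDerivation_apply, ← hc, hs, Module.Basis.repr_sum_self]
  choose δ hδ using h
  refine ⟨δ, fun i j => hinj ?_, fun i j r => hinj ?_, hδ⟩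
  · rw [← hδ, coordDerivation_apply, ← hb, Module.Basis.repr_self, Finsupp.single_apply]
    split_ifs <;> simp_all
  · rw [← hδ, ← hδ, ← hδ, ← hδ, coordDerivation_comm b _ hb]

end DualDerivations

/-! ### Calculus of orders of rational functions. -/

section Orders

variable {K : Type*} [Field K] {P : LocalSubring K} {x y : K} {a b : ℤ}

/-- Two generators of the maximal ideal differ by a unit. This allows one generator to be used for
several functions at once. -/
lemma hasOrd_iff {π : P.toSubring} (hπ : maximalIdeal P.toSubring = Ideal.span {π}) :
    HasOrd P x a ↔ x ≠ 0 ∧ ∃ w : P.toSubringˣ, x = ((w : P.toSubring) : K) * (π : K) ^ a := by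
  refine ⟨fun ⟨h0, π', w, hπ', hx⟩ => ⟨h0, ?_⟩, fun ⟨h0, w, hx⟩ => ⟨h0, π, w, hπ, hx⟩⟩
  obtain ⟨u, hu⟩ := (Ideal.span_singleton_eq_span_singleton.1 (hπ.symm.trans hπ'))
  refine ⟨w * u ^ a, ?_⟩
  have hc : ((((u ^ a : P.toSubringˣ) : P.toSubring)) : K) = ((u : P.toSubring) : K) ^ a := by
    have := congrArg Units.val
      (map_zpow (Units.map (P.toSubring.subtype : P.toSubring →* K)) u a)
    rwa [Units.val_zpow_eq_zpow_val] at this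
  rw [hx, ← hu]
  push_cast
  rw [hc, mul_zpow]
  ring

lemma HasOrd.ne_zero (h : HasOrd P x a) : x ≠ 0 := h.1

lemma HasOrd.mul (hx : HasOrd P x a) (hy : HasOrd P y b) : HasOrd P (x * y) (a + b) := by
  obtain ⟨hx0, π, u, hπ, hxu⟩ := hx
  obtain ⟨hy0, w, hyw⟩ := (hasOrd_iff hπ).1 hy
  refine ⟨mul_ne_zero hx0 hy0, π, u * w, hπ, ?_⟩
  -- `HasOrd` also makes sense when the maximal ideal is zero; nonzero elements then have order 0
  -- only.
  by_cases h0 : (π : K) = 0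
  · have ha : a = 0 := by
      by_contra ha
      exact hx0 (by rw [hxu, h0, zero_zpow _ ha, mul_zero])
    have hb : b = 0 := by
      by_contra hb
      exact hy0 (by rw [hyw, h0, zero_zpow _ hb, mul_zero])
    subst ha hb
    rw [hxu, hyw]
    simp
  · rw [zpow_add₀ h0, hxu, hyw]
    push_cast
    ring

lemma HasOrd.inv (hx : HasOrd P x a) : HasOrd P x⁻¹ (-a) := by
  obtain ⟨hx0, π, u, hπ, hxu⟩ := hx
  refine ⟨inv_ne_zero hx0, π, u⁻¹, hπ, ?_⟩
  have hu : (((u⁻¹ : P.toSubringˣ) : P.toSubring) : K) = ((u : P.toSubring) : K)⁻¹ := by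
    refine eq_inv_of_mul_eq_one_left ?_
    rw [← Subring.coe_mul, Units.inv_mul, Subring.coe_one]
  rw [hxu, hu, mul_inv, zpow_neg]

lemma HasOrd.div (hx : HasOrd P x a) (hy : HasOrd P y b) : HasOrd P (x / y) (a - b) := by
  rw [div_eq_mul_inv, sub_eq_add_neg]
  exact hx.mul hy.inv

lemma HasOrd.one (hx : HasOrd P x a) : HasOrd P (1 : K) 0 := by
  obtain ⟨-, π, -, hπ, -⟩ := hx
  exact ⟨one_ne_zero, π, 1, hπ, by simp⟩

lemma HasOrd.pow (hx : HasOrd P x a) (n : ℕ) : HasOrd P (x ^ n) (n * a) := by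
  induction n with
  | zero => simpa using hx.one
  | succ n ih =>
    rw [pow_succ]
    convert ih.mul hx using 1
    push_cast; ring

lemma HasOrd.zpow (hx : HasOrd P x a) (n : ℤ) : HasOrd P (x ^ n) (n * a) := by
  obtain ⟨m, rfl | rfl⟩ := n.eq_nat_or_neg
  · exact_mod_cast hx.pow m
  · rw [zpow_neg, neg_mul]
    exact_mod_cast (hx.pow m).inv

lemma HasOrd.mem (hx : HasOrd P x a) (ha : 0 ≤ a) : x ∈ P.toSubring := by
  obtain ⟨-, π, u, -, hxu⟩ := hx
  lift a to ℕ using ha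
  rw [hxu, zpow_natCast]
  exact (u * π ^ a : P.toSubring).2

lemma HasOrd.of_unit (hx : HasOrd P x a) (hy : y ∈ P.toSubring) (hy' : y⁻¹ ∈ P.toSubring)
    (hy0 : y ≠ 0) : HasOrd P y 0 := by
  obtain ⟨-, π, -, hπ, -⟩ := hx
  exact ⟨hy0, π, ⟨⟨y, hy⟩, ⟨y⁻¹, hy'⟩, Subtype.ext (mul_inv_cancel₀ hy0),
    Subtype.ext (inv_mul_cancel₀ hy0)⟩, hπ, by simp⟩

lemma HasOrd.mem_maximalIdeal (hx : HasOrd P x a) (ha : 0 < a) :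
    (⟨x, hx.mem ha.le⟩ : P.toSubring) ∈ maximalIdeal P.toSubring := by
  obtain ⟨h0, π, u, hπ, hxu⟩ := id hx
  obtain ⟨k, rfl⟩ : ∃ k : ℕ, a = k + 1 := ⟨(a - 1).toNat, by omega⟩
  have : (⟨x, hx.mem ha.le⟩ : P.toSubring) = u * π ^ k * π := by
    refine Subtype.ext ?_
    push_cast
    rw [hxu, ← Nat.cast_succ, zpow_natCast, pow_succ, mul_assoc]
  rw [this, hπ]
  exact Ideal.mul_mem_left _ _ (Ideal.mem_span_singleton_self π)

lemma inv_mem_of_notMem_maximalIdeal (P : LocalSubring K) {z : P.toSubring}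
    (hz : z ∉ maximalIdeal P.toSubring) : (z : K)⁻¹ ∈ P.toSubring := by
  have hu : IsUnit z := by
    by_contra h
    exact hz ((mem_maximalIdeal _).2 h)
  obtain ⟨u, rfl⟩ := hu
  have : ((u : P.toSubring) : K)⁻¹ = ((u⁻¹ : P.toSubringˣ) : P.toSubring) := by
    refine inv_eq_of_mul_eq_one_right ?_
    rw [← Subring.coe_mul, Units.mul_inv, Subring.coe_one]
  rw [this]
  exact Subtype.prop _

lemma notMem_maximalIdeal_of_inv_mem (P : LocalSubring K) {z : P.toSubring}
    (hz0 : (z : K) ≠ 0) (hz : (z : K)⁻¹ ∈ P.toSubring) : z ∉ maximalIdeal P.toSubring := by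
  rw [IsLocalRing.mem_maximalIdeal, mem_nonunits_iff, not_not]
  exact ⟨⟨z, ⟨_, hz⟩, Subtype.ext (mul_inv_cancel₀ hz0), Subtype.ext (inv_mul_cancel₀ hz0)⟩, rfl⟩

lemma HasOrd.unique (hx : HasOrd P x a) (hx' : HasOrd P x b) :
    a = b := by
  have key : ∀ {c : ℤ}, HasOrd P (1 : K) c → ¬ 0 < c := by
    intro c hc hpos
    have := hc.mem_maximalIdeal hpos
    exact (Ideal.ne_top_iff_one _).1 (maximalIdeal.isMaximal P.toSubring).ne_top this
  have h1 : HasOrd P (1 : K) (a - b) := by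
    simpa [div_self hx.1] using hx.div hx'
  have h2 : HasOrd P (1 : K) (b - a) := by
    simpa [div_self hx.1] using hx'.div hx
  have := key h1
  have := key h2
  omega

end Orders

/-! ### The filtration of a discrete valuation. -/

section DiscreteValuation

variable {K : Type*} [Field K] {E : LocalSubring K}

/-- The elements of order at least `t` for the discrete valuation with uniformizer `π`. -/
def ordFiltration (E : LocalSubring K) (π : K) (t : ℤ) : AddSubgroup K where
  carrier := {x | x * π ^ (-t) ∈ E.toSubring}
  zero_mem' := by simp
  add_mem' hx hy := by
    simp only [Set.mem_ofPred_eq, add_mul] at *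
    exact add_mem hx hy
  neg_mem' hx := by
    simp only [Set.mem_ofPred_eq, neg_mul] at *
    exact neg_mem hx

lemma mem_ordFiltration {π x : K} {t : ℤ} :
    x ∈ ordFiltration E π t ↔ x * π ^ (-t) ∈ E.toSubring := Iff.rfl

lemma HasOrd.mem_ordFiltration {π : E.toSubring} {x : K} {k : ℤ}
    (hπ : maximalIdeal E.toSubring = Ideal.span {π}) (hπ0 : (π : K) ≠ 0) (hx : HasOrd E x k)
    {t : ℤ} (ht : t ≤ k) : x ∈ ordFiltration E (π : K) t := by
  obtain ⟨-, u, hu⟩ := (hasOrd_iff hπ).1 hx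
  rw [LocalGerm.mem_ordFiltration]
  obtain ⟨m, hm⟩ := Int.le.dest ht
  have : x * (π : K) ^ (-t) = ((u * π ^ m : E.toSubring) : K) := by
    rw [hu, mul_assoc, ← zpow_add₀ hπ0, ← hm]
    push_cast
    rw [← zpow_natCast]
    congr 2; ring
  rw [this]
  exact Subtype.prop _

lemma exists_hasOrd (hE : IsDiscreteValuationRing E.toSubring) [IsFractionRing E.toSubring K]
    {x : K} (hx : x ≠ 0) : ∃ k, HasOrd E x k := by
  obtain ⟨π, hπ⟩ := IsDiscreteValuationRing.exists_irreducible E.toSubring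
  have hm : maximalIdeal E.toSubring = Ideal.span {π} := hπ.maximalIdeal_eq
  have h : ∀ r : E.toSubring, r ≠ 0 → ∃ k, HasOrd E (r : K) k := by
    intro r hr
    obtain ⟨n, u, hu⟩ := IsDiscreteValuationRing.eq_unit_mul_pow_irreducible hr hπ
    refine ⟨n, by simpa using hr, π, u, hm, ?_⟩
    rw [hu]
    push_cast
    rw [zpow_natCast]
  obtain ⟨r, s, hs, rfl⟩ := IsFractionRing.div_surjective (A := E.toSubring) x
  have hs0 : s ≠ 0 := nonZeroDivisors.ne_zero hs
  have hr0 : r ≠ 0 := by rintro rfl; simp at hx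
  obtain ⟨a, ha⟩ := h r hr0
  obtain ⟨b, hb⟩ := h s hs0
  exact ⟨_, ha.div hb⟩

lemma coe_uniformizer_ne_zero (hE : IsDiscreteValuationRing E.toSubring) {π : E.toSubring}
    (hπ : maximalIdeal E.toSubring = Ideal.span {π}) : (π : K) ≠ 0 := by
  intro h
  apply IsDiscreteValuationRing.not_a_field E.toSubring
  rw [hπ, Ideal.span_singleton_eq_bot]
  exact Subtype.ext h

lemma isValuationFiltration_ordFiltration (hE : IsDiscreteValuationRing E.toSubring)
    [IsFractionRing E.toSubring K] {π : E.toSubring}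
    (hπ : maximalIdeal E.toSubring = Ideal.span {π}) :
    IsValuationFiltration (ordFiltration E (π : K)) := by
  have hπ0 := coe_uniformizer_ne_zero hE hπ
  refine ⟨?_, ?_, ?_⟩
  · intro s t hst x hx
    rw [mem_ordFiltration] at hx ⊢
    obtain ⟨m, hm⟩ := Int.le.dest hst
    have : x * (π : K) ^ (-s) = x * (π : K) ^ (-t) * (π : K) ^ m := by
      rw [mul_assoc, ← zpow_natCast, ← zpow_add₀ hπ0]
      congr 2; omega
    rw [this]
    exact mul_mem hx (pow_mem π.2 m)
  · intro s t x y hx hy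
    rw [mem_ordFiltration] at *
    have : x * y * (π : K) ^ (-(s + t)) = (x * (π : K) ^ (-s)) * (y * (π : K) ^ (-t)) := by
      rw [neg_add, zpow_add₀ hπ0]; ring
    rw [this]
    exact mul_mem hx hy
  · intro s t x y hx hxy
    by_cases hx0 : x = 0
    · exact absurd (zero_mem _) (hx0 ▸ hx)
    obtain ⟨k, hk⟩ := exists_hasOrd hE hx0
    have hks : k ≤ s := by
      by_contra! hlt
      exact hx (hk.mem_ordFiltration hπ hπ0 (by omega))
    have hinv := hk.inv.mem_ordFiltration hπ hπ0 (le_refl _)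
    rw [mem_ordFiltration] at *
    have : y * (π : K) ^ (-t) = (x⁻¹ * (π : K) ^ (-(-k))) * (x * y * (π : K) ^ (-(s + t))) *
        (π : K) ^ (s - k) := by
      have h1 : (π : K) ^ (-t) = (π : K) ^ (-(-k)) * (π : K) ^ (-(s + t)) * (π : K) ^ (s - k) := by
        rw [← zpow_add₀ hπ0, ← zpow_add₀ hπ0]; congr 1; ring
      rw [h1]; field_simp
    rw [this]
    refine mul_mem (mul_mem hinv hxy) ?_
    obtain ⟨m, hm⟩ := Int.le.dest hks
    rw [← hm, add_sub_cancel_left, zpow_natCast]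
    exact pow_mem π.2 m

end DiscreteValuation

/-! ### Volume forms and Jacobians. -/

section Wedge

variable {K : Type*} [Field K] [Algebra ℂ K] {d : ℕ}

/-- Expand both new differentials in the basis `b`. A repeated basis vector kills a term, so only
the directions `i` and `j`, in their two orders, contribute. -/
lemma wedgeD_update_update {x : Fin d → K} (b : Module.Basis (Fin d) K Ω[K⁄ℂ])
    (hb : ∀ i, b i = KaehlerDifferential.D ℂ K (x i)) {i j : Fin d} (hij : i ≠ j) (g h : K) :
    wedgeD (Function.update (Function.update x i g) j h) =
      (coordDerivation b i g * coordDerivation b j h -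
        coordDerivation b j g * coordDerivation b i h) • wedgeD x := by
  have hx : (fun k => KaehlerDifferential.D ℂ K (x k)) = b := funext fun k => (hb k).symm
  have hup : (fun k => KaehlerDifferential.D ℂ K
      (Function.update (Function.update x i g) j h k)) =
      Function.update (Function.update b i (KaehlerDifferential.D ℂ K g)) j
        (KaehlerDifferential.D ℂ K h) := by
    funext k
    by_cases hk : k = j
    · subst hk; simp
    · by_cases hk' : k = i
      · subst hk'; simp [hk]
      · simp [hk, hk', hb]
  rw [wedgeD, wedgeD, hup, hx]
  set f := exteriorPower.ιMulti K d (M := Ω[K⁄ℂ])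
  have h1 : ∀ k, k ≠ i → k ≠ j → ∀ v, f (Function.update (Function.update b i (b k)) j v) = 0 := by
    intro k hki hkj v
    refine f.map_eq_zero_of_eq _ (i := i) (j := k) ?_ (Ne.symm hki)
    simp [hki, hkj, hij]
  have h2 : ∀ l, l ≠ i → l ≠ j → ∀ v, f (Function.update (Function.update b i v) j (b l)) = 0 := by
    intro l hli hlj v
    refine f.map_eq_zero_of_eq _ (i := j) (j := l) ?_ (Ne.symm hlj)
    simp [hli, hlj]
  have h3 : f (Function.update (Function.update b i (b i)) j (b j)) = f b := by simp
  have h4 : f (Function.update (Function.update b i (b j)) j (b i)) = - f b := by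
    rw [← f.map_swap b hij]
    congr 1
    funext k
    by_cases hk : k = j
    · subst hk; simp
    · by_cases hk' : k = i
      · subst hk'; simp [hk]
      · simp [hk, hk', Equiv.swap_apply_of_ne_of_ne]
  have h5 : ∀ k, f (Function.update (Function.update b i (b k)) j (b k)) = 0 := by
    intro k
    refine f.map_eq_zero_of_eq _ (i := i) (j := j) ?_ hij
    simp [hij]
  rw [← sum_coordDerivation b g, ← sum_coordDerivation b h, f.map_update_sum]
  have h6 : ∀ l, f (Function.update (Function.update b i (∑ k, coordDerivation b k g • b k)) j
      (coordDerivation b l h • b l)) = coordDerivation b l h •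
        ∑ k, coordDerivation b k g • f (Function.update (Function.update b i (b k)) j (b l)) := by
    intro l
    rw [f.map_update_smul]
    congr 1
    rw [Function.update_comm hij, f.map_update_sum]
    refine Finset.sum_congr rfl fun k _ => ?_
    rw [f.map_update_smul, Function.update_comm hij.symm]
  simp_rw [h6]
  rw [Finset.sum_eq_add_of_mem i j (Finset.mem_univ _) (Finset.mem_univ _) hij,
    Finset.sum_eq_single_of_mem j (Finset.mem_univ _),
    Finset.sum_eq_single_of_mem i (Finset.mem_univ _), h3, h4]
  · module
  · intro k _ hk
    by_cases hkj : k = j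
    · rw [hkj, h5, smul_zero]
    · rw [h1 k hk hkj, smul_zero]
  · intro k _ hk
    by_cases hki : k = i
    · rw [hki, h5, smul_zero]
    · rw [h1 k hki hk, smul_zero]
  · intro l _ ⟨hli, hlj⟩
    rw [Finset.sum_eq_zero, smul_zero]
    intro k _
    rw [h2 l hli hlj, smul_zero]

lemma wedgeD_ne_zero {x : Fin d → K} (b : Module.Basis (Fin d) K Ω[K⁄ℂ])
    (hb : ∀ i, b i = KaehlerDifferential.D ℂ K (x i)) : wedgeD x ≠ 0 := by
  intro h
  have hx : (fun k => KaehlerDifferential.D ℂ K (x k)) = b := funext fun k => (hb k).symm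
  have := congrArg (exteriorPower.alternatingMapLinearEquiv b.det) h
  rw [wedgeD, hx, exteriorPower.alternatingMapLinearEquiv_apply_ιMulti, Module.Basis.det_self,
    map_zero] at this
  exact one_ne_zero this

lemma exists_eq_smul_wedgeD {x : Fin d → K} (b : Module.Basis (Fin d) K Ω[K⁄ℂ])
    (hb : ∀ i, b i = KaehlerDifferential.D ℂ K (x i)) (ω : ⋀[K]^d Ω[K⁄ℂ]) :
    ∃ g : K, ω = g • wedgeD x := by
  have := Module.Finite.of_basis b
  have h1 : Module.finrank K (⋀[K]^d Ω[K⁄ℂ]) = 1 := by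
    rw [exteriorPower.finrank_eq, Module.finrank_eq_card_basis b, Fintype.card_fin,
      Nat.choose_self]
  obtain ⟨g, hg⟩ := (finrank_eq_one_iff_of_nonzero' _ (wedgeD_ne_zero b hb)).1 h1 ω
  exact ⟨g, hg.symm⟩

/-- The top exterior power is a line, so the factor can be read off by applying the determinant form
of `b`. -/
lemma wedgeD_eq_det_smul {x : Fin d → K} (b : Module.Basis (Fin d) K Ω[K⁄ℂ])
    (hb : ∀ i, b i = KaehlerDifferential.D ℂ K (x i)) (y : Fin d → K) :
    wedgeD y = (Matrix.of fun i j => coordDerivation b i (y j)).det • wedgeD x := by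
  have hx : (fun k => KaehlerDifferential.D ℂ K (x k)) = b := funext fun k => (hb k).symm
  obtain ⟨g, hg⟩ := exists_eq_smul_wedgeD b hb (wedgeD y)
  have := congrArg (exteriorPower.alternatingMapLinearEquiv b.det) hg
  rw [map_smul, wedgeD, wedgeD, hx, exteriorPower.alternatingMapLinearEquiv_apply_ιMulti,
    exteriorPower.alternatingMapLinearEquiv_apply_ιMulti, Module.Basis.det_self, smul_eq_mul,
    mul_one, Module.Basis.det_apply] at this
  rw [hg, ← this]
  rfl

end Wedge

/-! ### Orders of differential forms along divisors. -/

section Forms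

variable {K : Type*} [Field K] [Algebra ℂ K] {d : ℕ}

lemma span_D_subring (P : Subring K) [IsFractionRing P K] :
    Submodule.span K (Set.range fun y : P => KaehlerDifferential.D ℂ K (y : K)) = ⊤ := by
  rw [eq_top_iff, ← KaehlerDifferential.span_range_derivation ℂ K, Submodule.span_le]
  rintro _ ⟨g, rfl⟩
  obtain ⟨a, s, hs, rfl⟩ := IsFractionRing.div_surjective (A := P) g
  rw [Derivation.leibniz_div]
  exact Submodule.smul_mem _ _ (sub_mem
    (Submodule.smul_mem _ _ (Submodule.subset_span ⟨a, rfl⟩))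
    (Submodule.smul_mem _ _ (Submodule.subset_span ⟨s, rfl⟩)))

/-- If `d`-forms have orders along a divisor, then `d` is the dimension of `K`. -/
lemma finrank_kaehlerDifferential_of_hasOrdForm [Module.Finite K Ω[K⁄ℂ]] (hd : d ≠ 0)
    {P : LocalSubring K} [IsFractionRing P.toSubring K] {ω : ⋀[K]^d Ω[K⁄ℂ]} {k : ℤ}
    (h : HasOrdForm P ω k) : Module.finrank K Ω[K⁄ℂ] = d := by
  obtain ⟨x, -, hx0, hx, -⟩ := h
  classical
  let : LinearOrder P.toSubring := linearOrderOfSTO WellOrderingRel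
  have hspan := exteriorPower.ιMulti_family_span_of_span K (n := d)
    (span_D_subring (K := K) P.toSubring)
  -- Wedges of differentials of elements of `P` span the exterior power, and all are multiples of
  -- one. So a binomial coefficient equals 1, which with `d ≠ 0` determines the rank.
  have h1 : Module.finrank K (⋀[K]^d Ω[K⁄ℂ]) = 1 := by
    rw [finrank_eq_one_iff_of_nonzero _ hx0, eq_top_iff, ← hspan, Submodule.span_le]
    rintro _ ⟨s, rfl⟩
    obtain ⟨c, hc⟩ := hx (Set.powersetCard.ofFinEmbEquiv.symm s)
    exact Submodule.mem_span_singleton.2 ⟨c, hc.symm⟩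
  rw [exteriorPower.finrank_eq, Nat.choose_eq_one_iff] at h1
  tauto

/-- Two generators of the regular forms are multiples of each other over `P`, hence differ by a
unit: the order of a form does not depend on the generator. -/
lemma hasOrd_of_smul_eq_smul {P : LocalSubring K} {x y : Fin d → P.toSubring}
    (hx : ∀ z : Fin d → P.toSubring, ∃ c : P.toSubring,
      wedgeD (fun i => (z i : K)) = (c : K) • wedgeD (fun i => (x i : K)))
    (hy0 : wedgeD (fun i => (y i : K)) ≠ 0)
    (hy : ∀ z : Fin d → P.toSubring, ∃ c : P.toSubring,
      wedgeD (fun i => (z i : K)) = (c : K) • wedgeD (fun i => (y i : K)))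
    {g h : K} (hgh : g • wedgeD (fun i => (x i : K)) = h • wedgeD (fun i => (y i : K)))
    {k : ℤ} (hg : HasOrd P g k) : HasOrd P h k := by
  obtain ⟨c, hc⟩ := hx y
  obtain ⟨c', hc'⟩ := hy x
  have h1 : (c : K) * c' = 1 := by
    rw [hc', smul_smul] at hc
    have := sub_eq_zero.2 hc
    nth_rewrite 1 [← one_smul K (wedgeD fun i => (y i : K))] at this
    rw [← sub_smul, smul_eq_zero, or_iff_left hy0, sub_eq_zero] at this
    exact this.symm
  have hc0 : (c' : K) ≠ 0 := right_ne_zero_of_mul_eq_one h1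
  have h2 : h = g * c' := by
    rw [hc', smul_smul, ← sub_eq_zero, ← sub_smul, smul_eq_zero, or_iff_left hy0,
      sub_eq_zero] at hgh
    exact hgh.symm
  rw [h2]
  have := hg.mul (hg.of_unit c'.2 (by rw [← eq_inv_of_mul_eq_one_left h1]; exact c.2) hc0)
  simpa using this

lemma HasOrdForm.hasOrd_of_eq_smul {P : LocalSubring K} {ω ω' : ⋀[K]^d Ω[K⁄ℂ]} {k k' : ℤ}
    (h : HasOrdForm P ω k) (h' : HasOrdForm P ω' k') {g : K} (hg : ω = g • ω') :
    HasOrd P g (k - k') := by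
  obtain ⟨x, a, -, hx, rfl, ha⟩ := h
  obtain ⟨y, b, hy0, hy, rfl, hb⟩ := h'
  rw [smul_smul] at hg
  have := (hasOrd_of_smul_eq_smul hx hy0 hy hg ha).div hb
  rwa [mul_div_cancel_right₀ _ hb.ne_zero] at this

/-- The bracket of two functions for a rational volume form `dx₁ ∧ ⋯ ∧ dx_d` has, along the divisor
`E`, a pole bounded by the log discrepancy. -/
lemma bracket_mem_ordFiltration {E : LocalSubring K} (hE : IsDiscreteValuationRing E.toSubring)
    [IsFractionRing E.toSubring K] {π : E.toSubring}
    (hπ : maximalIdeal E.toSubring = Ideal.span {π}) {x : Fin d → K}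
    (b : Module.Basis (Fin d) K Ω[K⁄ℂ]) (hb : ∀ i, b i = KaehlerDifferential.D ℂ K (x i))
    (hx : ∀ i, x i ∈ E.toSubring) {j : ℤ} (hj : HasOrdForm E (wedgeD x) j) (i k : Fin d)
    {s t : ℤ} {g h : K} (hg : g ∈ ordFiltration E (π : K) s) (hh : h ∈ ordFiltration E (π : K) t) :
    coordDerivation b i g * coordDerivation b k h - coordDerivation b k g * coordDerivation b i h ∈
      ordFiltration E (π : K) (s + t - (j + 1)) := by
  by_cases hik : i = k
  · subst hik
    rw [mul_comm, sub_self]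
    exact zero_mem _
  have hF := isValuationFiltration_ordFiltration hE hπ
  have hπ0 := coe_uniformizer_ne_zero hE hπ
  -- For `u`, `v` regular along `E`, replacing two coordinates by them gives a regular form, so the
  -- bracket has a pole of order at most `j`.
  have hbr : ∀ u v : K, u ∈ E.toSubring → v ∈ E.toSubring →
      coordDerivation b i u * coordDerivation b k v - coordDerivation b k u * coordDerivation b i v
        ∈ ordFiltration E (π : K) (-j) := by
    intro u v hu hv
    obtain ⟨ξ, J, hξ0, hξ, hJ, hJj⟩ := hj
    have hy : ∀ l, Function.update (Function.update x i u) k v l ∈ E.toSubring := by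
      intro l
      by_cases hlk : l = k
      · subst hlk; simpa
      · by_cases hli : l = i
        · subst hli; simpa [hlk]
        · simpa [hlk, hli] using hx l
    obtain ⟨c, hc⟩ := hξ fun l => ⟨_, hy l⟩
    rw [wedgeD_update_update b hb hik, hJ, smul_smul, ← sub_eq_zero, ← sub_smul, smul_eq_zero,
      or_iff_left hξ0, sub_eq_zero] at hc
    rw [eq_div_of_mul_eq hJj.ne_zero hc, div_eq_mul_inv, ← zero_add (-j)]
    refine hF.mul_mem ?_ (hJj.inv.mem_ordFiltration hπ hπ0 le_rfl)
    simp [mem_ordFiltration]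
  have hex : ∀ {m : ℤ} {z : K}, z ∈ ordFiltration E (π : K) m →
      ∃ u ∈ E.toSubring, z = u * (π : K) ^ m := fun {m z} hz =>
    ⟨_, hz, by rw [mul_assoc, ← zpow_add₀ hπ0]; simp⟩
  obtain ⟨u, hu, rfl⟩ := hex hg
  obtain ⟨v, hv, rfl⟩ := hex hh
  -- Differentiating the power of `π` loses one further power, which turns `j` into `j + 1`. Only
  -- one is lost, because the term in which both powers are differentiated is a bracket of `π` with
  -- itself.
  have hD : ∀ (l : Fin d) (z : K) (m : ℤ), coordDerivation b l (z * (π : K) ^ m) =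
      (π : K) ^ m * coordDerivation b l z + m * z * (π : K) ^ (m - 1) * coordDerivation b l π := by
    intro l z m
    rw [Derivation.leibniz, Derivation.leibniz_zpow]
    simp only [smul_eq_mul, zsmul_eq_mul]
    ring
  have hp : ∀ m : ℤ, (π : K) ^ m = (π : K) ^ (m - 1) * π := by
    intro m
    rw [← zpow_add_one₀ hπ0]; simp
  have h1 := hbr u v hu hv
  have h2 := hbr u π hu π.2
  have h3 := hbr π v π.2 hv
  rw [hD, hD, hD, hD]
  have hmem : ∀ {m : ℤ} {z : K}, z ∈ E.toSubring →
      z * (π : K) ^ m ∈ ordFiltration E (π : K) m := by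
    intro m z hz
    rw [mem_ordFiltration, mul_assoc, ← zpow_add₀ hπ0]
    simpa
  have hint : ∀ m : ℤ, (m : K) ∈ E.toSubring := fun m => intCast_mem _ m
  have e1 : (1 : K) ∈ E.toSubring := one_mem _
  have t1 := hF.mul_mem (hmem (m := s + t) e1) h1
  have t2 := hF.mul_mem (hmem (m := s + t - 1) (mul_mem (hint t) hv)) h2
  have t3 := hF.mul_mem (hmem (m := s + t - 1) (mul_mem (hint s) hu)) h3
  have tt := add_mem (add_mem (hF.anti (show s + t - (j + 1) ≤ s + t + -j by omega) t1)
    (hF.anti (show s + t - (j + 1) ≤ s + t - 1 + -j by omega) t2))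
    (hF.anti (show s + t - (j + 1) ≤ s + t - 1 + -j by omega) t3)
  convert tt using 1
  have e2 : (π : K) ^ (s + t) = (π : K) ^ (s - 1) * π * ((π : K) ^ (t - 1) * π) := by
    rw [zpow_add₀ hπ0, ← hp, ← hp]
  have e3 : (π : K) ^ (s + t - 1) = (π : K) ^ (s - 1) * ((π : K) ^ (t - 1) * π) := by
    rw [← hp, ← zpow_add₀ hπ0]; congr 1; ring
  rw [e2, e3, hp s, hp t]
  ring

end Forms

/-! ### Localizations inside the function field. -/

section Localizations

variable {K : Type*} [Field K]

lemma mem_ofPrime_iff {B : Subring K} {P : Ideal B} [P.IsPrime] {z : K} :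
    z ∈ (LocalSubring.ofPrime B P).toSubring ↔ ∃ a s : B, s ∉ P ∧ z = a / s := by
  constructor
  · intro hz
    obtain ⟨⟨a, s⟩, h⟩ := IsLocalization.surj P.primeCompl
      (⟨z, hz⟩ : (LocalSubring.ofPrime B P).toSubring)
    refine ⟨a, s, s.2, ?_⟩
    have h' : z * (s : B) = (a : K) := congrArg Subtype.val h
    have hs0 : ((s : B) : K) ≠ 0 := fun h0 => s.2 (by
      have : (s : B) = 0 := Subtype.ext h0
      rw [this]; exact P.zero_mem)
    exact eq_div_of_mul_eq hs0 h'
  · rintro ⟨a, s, hs, rfl⟩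
    have hu : IsUnit (algebraMap B (LocalSubring.ofPrime B P).toSubring s) :=
      IsLocalization.map_units _ (⟨s, hs⟩ : P.primeCompl)
    rw [div_eq_mul_inv]
    refine mul_mem (LocalSubring.le_ofPrime B P a.2) ?_
    refine inv_mem_of_notMem_maximalIdeal _ (z := algebraMap B _ s) ?_
    rw [IsLocalRing.mem_maximalIdeal, mem_nonunits_iff, not_not]
    exact hu

lemma coe_ne_zero_of_notMem {B : Subring K} {P : Ideal B} {s : B} (hs : s ∉ P) : (s : K) ≠ 0 :=
  fun h0 => hs (by rw [show s = 0 from Subtype.ext h0]; exact P.zero_mem)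

lemma inclusion_mem_maximalIdeal_ofPrime {B : Subring K} {P : Ideal B} [P.IsPrime] {a : B} :
    (⟨a, LocalSubring.le_ofPrime B P a.2⟩ : (LocalSubring.ofPrime B P).toSubring) ∈
      maximalIdeal (LocalSubring.ofPrime B P).toSubring ↔ a ∈ P :=
  IsLocalization.AtPrime.to_map_mem_maximal_iff (LocalSubring.ofPrime B P).toSubring P a

lemma mem_maximalIdeal_ofPrime_iff {B : Subring K} {P : Ideal B} [P.IsPrime]
    {s : (LocalSubring.ofPrime B P).toSubring} {a : B} (h : (s : K) = a) :
    s ∈ maximalIdeal (LocalSubring.ofPrime B P).toSubring ↔ a ∈ P := by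
  rw [show s = ⟨a, LocalSubring.le_ofPrime B P a.2⟩ from Subtype.ext h]
  exact inclusion_mem_maximalIdeal_ofPrime

/-- If `B` lies between `B₀` and a local ring of `B₀`, then it has the same local ring. -/
lemma ofPrime_eq_ofPrime_comap {B₀ B : Subring K} (h₀ : B₀ ≤ B) (P : Ideal B) [P.IsPrime]
    (hB : B ≤ (LocalSubring.ofPrime B₀ (P.comap (Subring.inclusion h₀))).toSubring) :
    LocalSubring.ofPrime B P = LocalSubring.ofPrime B₀ (P.comap (Subring.inclusion h₀)) := by
  refine LocalSubring.toSubring_injective (le_antisymm ?_ ?_)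
  · intro z hz
    obtain ⟨a, s, hs, rfl⟩ := mem_ofPrime_iff.1 hz
    rw [div_eq_mul_inv]
    refine mul_mem (hB a.2) ?_
    obtain ⟨s', t, ht, hst⟩ := mem_ofPrime_iff.1 (hB s.2)
    have hs' : s' ∉ P.comap (Subring.inclusion h₀) := by
      intro hmem
      have : Subring.inclusion h₀ s' = s * Subring.inclusion h₀ t := Subtype.ext (by
        change (s' : K) = s * t
        rw [hst, div_mul_cancel₀ _ (coe_ne_zero_of_notMem ht)])
      rw [Ideal.mem_comap, this] at hmem
      exact (Ideal.IsPrime.mem_or_mem inferInstance hmem).elim hs ht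
    rw [hst, inv_div]
    exact mem_ofPrime_iff.2 ⟨t, s', hs', rfl⟩
  · intro z hz
    obtain ⟨a, s, hs, rfl⟩ := mem_ofPrime_iff.1 hz
    exact mem_ofPrime_iff.2 ⟨Subring.inclusion h₀ a, Subring.inclusion h₀ s, hs, rfl⟩

lemma ofPrime_ofPrime (B : Subring K) (P : Ideal B) [P.IsPrime]
    (p : Ideal (LocalSubring.ofPrime B P).toSubring) [p.IsPrime] :
    LocalSubring.ofPrime (LocalSubring.ofPrime B P).toSubring p =
      LocalSubring.ofPrime B (p.comap (Subring.inclusion (LocalSubring.le_ofPrime B P))) := by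
  refine ofPrime_eq_ofPrime_comap _ p ?_
  intro z hz
  obtain ⟨a, s, hs, rfl⟩ := mem_ofPrime_iff.1 hz
  refine mem_ofPrime_iff.2 ⟨a, s, fun h => hs ?_, rfl⟩
  exact inclusion_mem_maximalIdeal_ofPrime.1 (le_maximalIdeal (Ideal.IsPrime.ne_top ‹_›) h)

lemma ofPrime_mem_affinePoints {B : Subring K} {S : LocalSubring K} (hS : S ∈ affinePoints B)
    (p : Ideal S.toSubring) [p.IsPrime] :
    LocalSubring.ofPrime S.toSubring p ∈ affinePoints B := by
  obtain ⟨P, hP, rfl⟩ := hS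
  exact ⟨_, inferInstance, ofPrime_ofPrime B P p⟩

lemma ringKrullDim_ofPrime (B : Subring K) (P : Ideal B) [P.IsPrime] :
    ringKrullDim (LocalSubring.ofPrime B P).toSubring = P.height :=
  IsLocalization.AtPrime.ringKrullDim_eq_height P _

lemma isNoetherianRing_ofPrime (B : Subring K) (P : Ideal B) [P.IsPrime] [IsNoetherianRing B] :
    IsNoetherianRing (LocalSubring.ofPrime B P).toSubring :=
  IsLocalization.isNoetherianRing P.primeCompl _ inferInstance

lemma isIntegrallyClosed_ofPrime (B : Subring K) (P : Ideal B) [P.IsPrime]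
    [IsIntegrallyClosed B] : IsIntegrallyClosed (LocalSubring.ofPrime B P).toSubring :=
  isIntegrallyClosed_of_isLocalization (R := B) _ P.primeCompl P.primeCompl_le_nonZeroDivisors

lemma isFractionRing_of_le {A : Type*} [CommRing A] [Algebra A K] [IsFractionRing A K]
    {B : Subring K} (h : (algebraMap A K).range ≤ B) : IsFractionRing B K := by
  refine IsFractionRing.of_field B K fun z => ?_
  obtain ⟨a, b, -, rfl⟩ := IsFractionRing.div_surjective (A := A) z
  exact ⟨⟨_, h ⟨a, rfl⟩⟩, ⟨_, h ⟨b, rfl⟩⟩, rfl⟩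

lemma isDiscreteValuationRing_of_hasOrd {P : LocalSubring K} [IsNoetherianRing P.toSubring]
    (hdim : ringKrullDim P.toSubring = 1) {x : K} {k : ℤ} (h : HasOrd P x k) :
    IsDiscreteValuationRing P.toSubring := by
  have hf : ¬ IsField P.toSubring := by
    intro hf
    rw [ringKrullDim_eq_zero_of_isField hf] at hdim
    exact zero_ne_one hdim
  obtain ⟨-, π, -, hπ, -⟩ := h
  have hp : (maximalIdeal P.toSubring).IsPrincipal := ⟨⟨π, hπ⟩⟩
  exact ((IsDiscreteValuationRing.TFAE P.toSubring hf).out 0 4).2 hp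

/-- No ring lies strictly between a discrete valuation ring and its field: powers of an element of
negative order absorb every pole. -/
lemma eq_of_le_of_isDiscreteValuationRing {P Q : LocalSubring K}
    [IsFractionRing P.toSubring K] (hP : IsDiscreteValuationRing P.toSubring)
    (hPQ : P.toSubring ≤ Q.toSubring) (hQ : Q.toSubring ≠ ⊤) : P = Q := by
  refine LocalSubring.toSubring_injective (le_antisymm hPQ ?_)
  intro z hz
  by_contra hzP
  obtain ⟨k, hk⟩ := exists_hasOrd hP (x := z) (by rintro rfl; exact hzP (zero_mem _))
  have hk0 : k < 0 := by
    by_contra! h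
    exact hzP (hk.mem h)
  apply hQ
  rw [eq_top_iff]
  intro y _
  by_cases hy : y = 0
  · rw [hy]; exact zero_mem _
  obtain ⟨m, hm⟩ := exists_hasOrd hP hy
  have h1 := hm.mul (hk.pow m.natAbs).inv
  have h2 : y * (z ^ m.natAbs)⁻¹ ∈ P.toSubring := by
    refine h1.mem ?_
    have : |m| ≤ m.natAbs * -k := by
      rw [Int.natCast_natAbs]
      nlinarith [abs_nonneg m]
    have := neg_abs_le m
    linarith
  have h3 : y = y * (z ^ m.natAbs)⁻¹ * z ^ m.natAbs := by
    field_simp [hk.ne_zero]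
  rw [h3]
  exact mul_mem (hPQ h2) (pow_mem hz _)

end Localizations

/-! ### Regularity tested in codimension one. -/

section HeightOne

variable {K : Type*} [Field K]

/-- In a noetherian normal local domain of dimension at least two, the maximal ideal has depth at
least two. -/
lemma mem_of_maximalIdeal_mul_mem {S : Subring K} [IsFractionRing S K] [IsLocalRing S]
    [IsNoetherianRing S] [IsIntegrallyClosed S] (hdim : 1 < ringKrullDim S) {z : K}
    (hz : ∀ s ∈ maximalIdeal S, (s : K) * z ∈ S) : z ∈ S := by
  have hbot : maximalIdeal S ≠ ⊥ := by
    intro h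
    rw [ringKrullDim_eq_zero_of_isField (isField_iff_maximalIdeal_eq.2 h)] at hdim
    exact absurd hdim (by decide)
  -- If `z` maps the maximal ideal to itself, it is integral by Cayley–Hamilton. Otherwise some `t *
  -- z` is a unit, the maximal ideal is generated by `t`, and the dimension is at most one.
  by_cases hcase : ∀ (s) (hs : s ∈ maximalIdeal S), (⟨_, hz s hs⟩ : S) ∈ maximalIdeal S
  · have hint : IsIntegral S z := by
      refine isIntegral_of_smul_mem_submodule
        (Submodule.map (Algebra.linearMap S K) (maximalIdeal S)) ?_ ?_ z ?_
      · intro h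
        apply hbot
        rw [eq_bot_iff]
        intro s hs
        have : (s : K) ∈ Submodule.map (Algebra.linearMap S K) (maximalIdeal S) := ⟨s, hs, rfl⟩
        rw [h, Submodule.mem_bot] at this
        exact Subtype.ext this
      · exact Submodule.FG.map _ (IsNoetherian.noetherian _)
      · rintro _ ⟨s, hs, rfl⟩
        exact ⟨_, hcase s hs, mul_comm _ _⟩
    obtain ⟨y, hy⟩ := IsIntegrallyClosed.isIntegral_iff.1 hint
    rw [← hy]
    exact y.2
  · exfalso
    push Not at hcase
    obtain ⟨t, ht, htz⟩ := hcase
    rw [IsLocalRing.mem_maximalIdeal, mem_nonunits_iff, not_not] at htz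
    obtain ⟨u, hu⟩ := htz
    have hu' : ((u : S) : K) = t * z := congrArg Subtype.val hu
    have hp : maximalIdeal S = Ideal.span {t} := by
      refine le_antisymm (fun s hs => ?_) ((Ideal.span_singleton_le_iff_mem _).2 ht)
      rw [Ideal.mem_span_singleton']
      refine ⟨⟨_, hz s hs⟩ * ((u⁻¹ : Sˣ) : S), ?_⟩
      have : (⟨_, hz s hs⟩ : S) * t = s * u := Subtype.ext (by
        change (s : K) * z * t = s * (u : S)
        rw [hu']; ring)
      rw [mul_right_comm, this, mul_assoc, Units.mul_inv, mul_one]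
    have hh : (maximalIdeal S).height ≤ 1 := by
      have := Ideal.height_le_one_of_isPrincipal_of_mem_minimalPrimes (Ideal.span {t})
        (maximalIdeal S) (by
          rw [← hp, Ideal.minimalPrimes_eq_subsingleton_self]; rfl)
      exact this
    rw [← maximalIdeal_height_eq_ringKrullDim] at hdim
    exact absurd hdim (not_lt.2 (by exact_mod_cast hh))

/-- An element of the fraction field of a noetherian domain that belongs to all localizations at
primes of height one belongs to the domain, if the other nonzero primes have depth at least two. -/
lemma mem_of_forall_height_one {R : Subring K} [IsNoetherianRing R] [IsFractionRing R K] {h : K}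
    (hh : ∀ (p : Ideal R) [p.IsPrime], p.height = 1 → h ∈ (LocalSubring.ofPrime R p).toSubring)
    (hdepth : ∀ (P : Ideal R) [P.IsPrime], 1 < P.height → ∀ z : K,
      (∀ s ∈ P, (s : K) * z ∈ R) → z ∈ (LocalSubring.ofPrime R P).toSubring) : h ∈ R := by
  by_contra hR
  -- The ideal of denominators of `h`.
  let I : Ideal R := 
    { carrier := {s | (s : K) * h ∈ R}
      zero_mem' := by simp
      add_mem' := fun {a b} ha hb => by
        simp only [Set.mem_ofPred_eq, Subring.coe_add, add_mul] at *
        exact add_mem ha hb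
      smul_mem' := fun c a ha => by
        simp only [Set.mem_ofPred_eq, smul_eq_mul, Subring.coe_mul, mul_assoc] at *
        exact mul_mem c.2 ha }
  have hI : ∀ s : R, s ∈ I ↔ (s : K) * h ∈ R := fun _ => Iff.rfl
  have hI1 : (Ideal.Quotient.mk I 1) ≠ 0 := by
    rw [Ne, Ideal.Quotient.eq_zero_iff_mem, hI]
    simpa using hR
  -- For an associated prime `P` of `R ⧸ I`, some `r * h` is multiplied into `R` exactly by `P`, so
  -- it is not in the localization at `P`. This contradicts `hh` in height one and `hdepth` in
  -- larger height.
  obtain ⟨P, hP, -⟩ := exists_le_isAssociatedPrime_of_isNoetherianRing R _ hI1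
  obtain ⟨hPp, x, hx⟩ := isAssociatedPrime_iff.1 hP
  obtain ⟨r, rfl⟩ := Ideal.Quotient.mk_surjective x
  have hPm : ∀ s : R, s ∈ P ↔ (s : K) * (r * h) ∈ R := by
    intro s
    rw [hx, Submodule.mem_colon_singleton, Submodule.mem_bot, Algebra.smul_def,
      Ideal.Quotient.algebraMap_eq, ← map_mul, Ideal.Quotient.eq_zero_iff_mem, hI, Subring.coe_mul,
      mul_assoc]
  have hcon : (r : K) * h ∉ (LocalSubring.ofPrime R P).toSubring := by
    intro hmem
    obtain ⟨a, s, hs, has⟩ := mem_ofPrime_iff.1 hmem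
    apply hs
    rw [hPm, has, mul_div_cancel₀ _ (coe_ne_zero_of_notMem hs)]
    exact a.2
  have hP0 : P ≠ ⊥ := by
    rintro rfl
    obtain ⟨a, b, hb, rfl⟩ := IsFractionRing.div_surjective (A := R) h
    have hb0 : (b : K) ≠ 0 := by
      have := nonZeroDivisors.ne_zero hb
      exact fun h0 => this (Subtype.ext h0)
    have : b ∈ (⊥ : Ideal R) := by
      rw [hPm, mul_left_comm]
      refine mul_mem r.2 ?_
      change (b : K) * (a / b) ∈ R
      rw [mul_div_cancel₀ _ hb0]
      exact a.2
    exact hb0 (congrArg Subtype.val (Ideal.mem_bot.1 this))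
  have hht : P.height ≠ 0 := by
    rw [Ne, Ideal.height_eq_zero_iff, IsDomain.minimalPrimes_eq_singleton_bot]
    exact hP0
  rcases eq_or_ne P.height 1 with h1 | h1
  · exact hcon (mul_mem (LocalSubring.le_ofPrime R P r.2) (hh P h1))
  · refine hcon (hdepth P ?_ _ fun s hs => (hPm s).1 hs)
    exact lt_of_le_of_ne (Order.one_le_iff_ne_zero.2 hht) (Ne.symm h1)

lemma mem_ofPrime_of_mul_mem {R : Subring K} [IsNoetherianRing R] [IsFractionRing R K]
    {P : Ideal R} [P.IsPrime]
    (hn : IsIntegrallyClosed (LocalSubring.ofPrime R P).toSubring) (hP : 1 < P.height) {z : K}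
    (hz : ∀ s ∈ P, (s : K) * z ∈ R) : z ∈ (LocalSubring.ofPrime R P).toSubring := by
  have := isNoetherianRing_ofPrime R P
  have : IsFractionRing (LocalSubring.ofPrime R P).toSubring K := by
    refine isFractionRing_of_le (A := R) ?_
    rintro _ ⟨a, rfl⟩
    exact LocalSubring.le_ofPrime R P a.2
  refine mem_of_maximalIdeal_mul_mem ?_ ?_
  · rw [ringKrullDim_ofPrime]
    exact_mod_cast hP
  · intro s hs
    obtain ⟨a, t, ht, hst⟩ := mem_ofPrime_iff.1 s.2
    have ha : a ∈ P := by
      rw [← inclusion_mem_maximalIdeal_ofPrime]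
      have : (⟨a, LocalSubring.le_ofPrime R P a.2⟩ : (LocalSubring.ofPrime R P).toSubring) =
          s * ⟨t, LocalSubring.le_ofPrime R P t.2⟩ := Subtype.ext (by
        change (a : K) = s * t
        rw [hst, div_mul_cancel₀ _ (coe_ne_zero_of_notMem ht)])
      rw [this]
      exact Ideal.mul_mem_right _ _ hs
    rw [hst]
    exact mem_ofPrime_iff.2 ⟨⟨_, hz a ha⟩, t, ht, by rw [mul_div_right_comm]⟩

end HeightOne

/-! ### Local rings of the blow-up. -/

section Blowup

variable {A : Type*} [CommRing A] [IsLocalRing A] {K : Type*} [Field K] [Algebra A K]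

lemma range_le_blowupChart (x : A) : (algebraMap A K).range ≤ (blowupChart A K x).toSubring := by
  rintro _ ⟨a, rfl⟩
  exact (blowupChart A K x).algebraMap_mem a

lemma div_mem_blowupChart (x : A) {y : A} (hy : y ∈ maximalIdeal A) :
    algebraMap A K y / algebraMap A K x ∈ (blowupChart A K x).toSubring :=
  Algebra.subset_adjoin ⟨y, hy, rfl⟩

lemma blowupChart_le {x : A} {B : Subring K} (hB : (algebraMap A K).range ≤ B)
    (hx : ∀ y ∈ maximalIdeal A, algebraMap A K y / algebraMap A K x ∈ B) :
    (blowupChart A K x).toSubring ≤ B := by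
  intro z hz
  change z ∈ Algebra.adjoin A _ at hz
  induction hz using Algebra.adjoin_induction with
  | mem z hz =>
    obtain ⟨y, hy, rfl⟩ := hz
    exact hx y hy
  | algebraMap r => exact hB ⟨r, rfl⟩
  | add _ _ _ _ h1 h2 => exact add_mem h1 h2
  | mul _ _ _ _ h1 h2 => exact mul_mem h1 h2

lemma range_le_of_mem_blowup {S : LocalSubring K} (hS : S ∈ blowup A K) :
    (algebraMap A K).range ≤ S.toSubring := by
  obtain ⟨x, -, -, P, hP, rfl⟩ := hS
  exact (range_le_blowupChart x).trans (LocalSubring.le_ofPrime _ P)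

lemma ofPrime_mem_blowup {S : LocalSubring K} (hS : S ∈ blowup A K) (p : Ideal S.toSubring)
    [p.IsPrime] : LocalSubring.ofPrime S.toSubring p ∈ blowup A K := by
  obtain ⟨x, hx, hx0, h⟩ := hS
  exact ⟨x, hx, hx0, ofPrime_mem_affinePoints h p⟩

lemma finiteType_blowupChart [IsNoetherianRing A] (x : A) :
    Algebra.FiniteType A (blowupChart A K x) := by
  classical
  obtain ⟨s, hs⟩ := IsNoetherian.noetherian (maximalIdeal A)
  have hsm : ∀ y ∈ s, y ∈ maximalIdeal A := fun y hy => hs ▸ Submodule.subset_span hy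
  refine (blowupChart A K x).fg_iff_finiteType.1
    ⟨s.image fun y => algebraMap A K y / algebraMap A K x, le_antisymm ?_ ?_⟩
  · refine Algebra.adjoin_mono ?_
    intro z hz
    obtain ⟨y, hy, rfl⟩ := Finset.mem_image.1 (Finset.mem_coe.1 hz)
    exact ⟨y, hsm y hy, rfl⟩
  · refine Algebra.adjoin_le ?_
    rintro z ⟨y, hy, rfl⟩
    rw [← hs] at hy
    induction hy using Submodule.span_induction with
    | mem y hy => exact Algebra.subset_adjoin (Finset.mem_coe.2 (Finset.mem_image_of_mem _ hy))
    | zero => simp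
    | add y y' _ _ h h' =>
      rw [map_add, add_div]
      exact add_mem h h'
    | smul c y _ h =>
      rw [smul_eq_mul, map_mul, mul_div_assoc, ← Algebra.smul_def]
      exact Subalgebra.smul_mem _ h c

lemma isNoetherianRing_of_mem_blowup [IsNoetherianRing A] {S : LocalSubring K}
    (hS : S ∈ blowup A K) : IsNoetherianRing S.toSubring := by
  obtain ⟨x, -, -, P, hP, rfl⟩ := hS
  have := finiteType_blowupChart (K := K) x
  have : IsNoetherianRing (blowupChart A K x).toSubring :=
    Algebra.FiniteType.isNoetherianRing A (blowupChart A K x)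
  exact isNoetherianRing_ofPrime _ P

/-- On the chart of `x` every `y` in the maximal ideal is `(y / x) * x`, so `x` is an equation of
the exceptional divisor. -/
lemma exists_excIdeal_eq_span [FaithfulSMul A K] {S : LocalSubring K} (hS : S ∈ blowup A K) :
    ∃ q : S.toSubring, (q : K) ≠ 0 ∧ excIdeal A S = Ideal.span {q} := by
  have hle := range_le_of_mem_blowup hS
  obtain ⟨x, hx, hx0, P, hP, rfl⟩ := hS
  have hx0' : algebraMap A K x ≠ 0 := by
    rwa [Ne, FaithfulSMul.algebraMap_eq_zero_iff]
  refine ⟨⟨algebraMap A K x, hle ⟨x, rfl⟩⟩, hx0', le_antisymm ?_ ?_⟩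
  · refine Ideal.span_le.2 ?_
    rintro s ⟨a, ha, hs⟩
    refine Ideal.mem_span_singleton'.2
      ⟨⟨_, LocalSubring.le_ofPrime _ P (div_mem_blowupChart x ha)⟩, Subtype.ext ?_⟩
    rw [Subring.coe_mul, hs]
    exact div_mul_cancel₀ _ hx0'
  · exact (Ideal.span_singleton_le_iff_mem _).2 (Ideal.subset_span ⟨x, hx, rfl⟩)

/-- Away from `o` the chart variable `x` is invertible, so the fractions `y / x` lie already in a
localization of `A`. -/
lemma mem_germ_of_not_liesOver [FaithfulSMul A K] {S : LocalSubring K} (hS : S ∈ blowup A K)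
    (h : ¬ LiesOver A S) : S ∈ germ A K := by
  have hle := range_le_of_mem_blowup hS
  have hexc : ¬ excIdeal A S ≤ maximalIdeal S.toSubring := fun h' => h ⟨fun a => hle ⟨a, rfl⟩, h'⟩
  obtain ⟨x, hx, hx0, P, hP, hSP⟩ := hS
  have hx0' : algebraMap A K x ≠ 0 := by
    rwa [Ne, FaithfulSMul.algebraMap_eq_zero_iff]
  have hxP : (⟨algebraMap A K x, range_le_blowupChart x ⟨x, rfl⟩⟩ :
      (blowupChart A K x).toSubring) ∉ P := by
    intro hxP
    apply hexc
    refine Ideal.span_le.2 ?_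
    rintro s ⟨a, ha, hs⟩
    have hdiv : algebraMap A K a / algebraMap A K x ∈ S.toSubring :=
      hSP ▸ LocalSubring.le_ofPrime _ P (div_mem_blowupChart x ha)
    have hsx : s = (⟨_, hdiv⟩ : S.toSubring) * (⟨algebraMap A K x, hle ⟨x, rfl⟩⟩ : S.toSubring) := by
      refine Subtype.ext ?_
      rw [Subring.coe_mul, hs]
      exact (div_mul_cancel₀ _ hx0').symm
    have hxS : (⟨algebraMap A K x, hle ⟨x, rfl⟩⟩ : S.toSubring) ∈ maximalIdeal S.toSubring := by
      subst hSP
      exact (mem_maximalIdeal_ofPrime_iff rfl).2 hxP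
    rw [hsx]
    exact Ideal.mul_mem_left _ _ hxS
  refine ⟨_, inferInstance, hSP.trans (ofPrime_eq_ofPrime_comap (range_le_blowupChart x) P ?_)⟩
  refine blowupChart_le (LocalSubring.le_ofPrime _ _) fun y hy => ?_
  exact mem_ofPrime_iff.2 ⟨⟨_, y, rfl⟩, ⟨_, x, rfl⟩, hxP, rfl⟩

lemma liesOver_iff_of_mem_germ [FaithfulSMul A K] {p : Ideal (algebraMap A K).range} [p.IsPrime] :
    LiesOver A (LocalSubring.ofPrime (algebraMap A K).range p) ↔
      ∀ a ∈ maximalIdeal A, (algebraMap A K).rangeRestrict a ∈ p := by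
  have hle := LocalSubring.le_ofPrime (algebraMap A K).range p
  constructor
  · rintro ⟨-, h⟩ a ha
    exact (mem_maximalIdeal_ofPrime_iff rfl).1
      (h (Ideal.subset_span (a := ⟨_, hle ⟨a, rfl⟩⟩) ⟨a, ha, rfl⟩))
  · refine fun h => ⟨fun a => hle ⟨a, rfl⟩, Ideal.span_le.2 ?_⟩
    rintro s ⟨a, ha, hs⟩
    exact (mem_maximalIdeal_ofPrime_iff hs).2 (h a ha)

/-- The only point of the germ over `o` is `o` itself. -/
lemma ringKrullDim_of_liesOver_of_mem_germ [FaithfulSMul A K] {S : LocalSubring K}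
    (hS : S ∈ germ A K) (h : LiesOver A S) : ringKrullDim S.toSubring = ringKrullDim A := by
  obtain ⟨p, hp, rfl⟩ := hS
  let e : A ≃+* (algebraMap A K).range :=
    RingEquiv.ofBijective (algebraMap A K).rangeRestrict
      ⟨fun a b hab => FaithfulSMul.algebraMap_injective A K (congrArg Subtype.val hab),
        (algebraMap A K).rangeRestrict_surjective⟩
  rw [ringKrullDim_ofPrime]
  have h1 : p.comap e = maximalIdeal A := by
    refine le_antisymm (le_maximalIdeal (Ideal.IsPrime.ne_top inferInstance)) ?_
    exact fun a ha => liesOver_iff_of_mem_germ.1 h a ha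
  rw [← maximalIdeal_height_eq_ringKrullDim, ← h1, RingEquiv.height_comap]

lemma mem_blowup_of_mem_germ [FaithfulSMul A K] {S : LocalSubring K} (hS : S ∈ germ A K)
    (h : ¬ LiesOver A S) : S ∈ blowup A K := by
  obtain ⟨p, hp, rfl⟩ := hS
  rw [liesOver_iff_of_mem_germ] at h
  push Not at h
  obtain ⟨x, hx, hxp⟩ := h
  have hx0 : x ≠ 0 := by
    rintro rfl
    exact hxp (by rw [map_zero]; exact p.zero_mem)
  set S := LocalSubring.ofPrime (algebraMap A K).range p
  have hBS : (blowupChart A K x).toSubring ≤ S.toSubring :=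
    blowupChart_le (LocalSubring.le_ofPrime _ _) fun y hy =>
      mem_ofPrime_iff.2 ⟨⟨_, y, rfl⟩, ⟨_, x, rfl⟩, hxp, rfl⟩
  refine ⟨x, hx, hx0, (maximalIdeal S.toSubring).comap (Subring.inclusion hBS),
    inferInstance, ?_⟩
  have hcomap : ((maximalIdeal S.toSubring).comap (Subring.inclusion hBS)).comap
      (Subring.inclusion (range_le_blowupChart x)) = p := by
    ext a
    rw [Ideal.mem_comap, Ideal.mem_comap]
    exact mem_maximalIdeal_ofPrime_iff rfl
  have := ofPrime_eq_ofPrime_comap (range_le_blowupChart x)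
    ((maximalIdeal S.toSubring).comap (Subring.inclusion hBS)) (by simpa only [hcomap] using hBS)
  rw [this]
  simp only [hcomap, S]

end Blowup

/-! ### Rational functions on the normal germ. -/

section NormalGerm

variable {A : Type*} [CommRing A] [IsNoetherianRing A] [IsIntegrallyClosed A]
  {K : Type*} [Field K] [Algebra A K] [IsFractionRing A K]

variable (A K) in
/-- The local ring `A` as a subring of `K`. -/
def rangeEquiv : A ≃+* (algebraMap A K).range :=
  RingEquiv.ofBijective (algebraMap A K).rangeRestrict
    ⟨fun _ _ hab => IsFractionRing.injective A K (congrArg Subtype.val hab),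
      (algebraMap A K).rangeRestrict_surjective⟩

variable {A : Type*} [CommRing A] [IsIntegrallyClosed A] {K : Type*} [Field K] [Algebra A K]
  [IsFractionRing A K] in
lemma isIntegrallyClosed_of_mem_germ {S : LocalSubring K} (hS : S ∈ germ A K) :
    IsIntegrallyClosed S.toSubring := by
  obtain ⟨p, hp, rfl⟩ := hS
  have : IsIntegrallyClosed (algebraMap A K).range := IsIntegrallyClosed.of_equiv (rangeEquiv A K)
  exact isIntegrallyClosed_ofPrime _ p

/-- A rational function without poles along prime divisors is regular on a normal germ. -/
lemma mem_range_of_forall_hasOrd {h : K}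
    (hh : ∀ P ∈ primeDivisors (germ A K), ∃ k : ℤ, 0 ≤ k ∧ HasOrd P h k) :
    h ∈ (algebraMap A K).range := by
  have := isNoetherianRing_of_ringEquiv _ (rangeEquiv A K)
  have : IsFractionRing (algebraMap A K).range K := isFractionRing_of_le (A := A) le_rfl
  refine mem_of_forall_height_one (fun p _ hp => ?_) fun P _ hP z hz => ?_
  · obtain ⟨k, hk, hhk⟩ := hh (LocalSubring.ofPrime _ p)
      ⟨⟨p, inferInstance, rfl⟩, by rw [ringKrullDim_ofPrime, hp]; rfl⟩
    exact hhk.mem hk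
  · exact mem_ofPrime_of_mul_mem (isIntegrallyClosed_of_mem_germ ⟨P, inferInstance, rfl⟩) hP hz

end NormalGerm

/-! ### The exceptional divisor and its local equation. -/

section ExceptionalDivisor

variable {A : Type*} [CommRing A] [IsLocalRing A] [IsNoetherianRing A]
  {K : Type*} [Field K] [Algebra A K] [IsFractionRing A K]

variable {A : Type*} [CommRing A] [IsLocalRing A] {K : Type*} [Field K] [Algebra A K]
  [IsFractionRing A K] in
lemma toSubring_ne_top_of_mem_excPoints {Q : LocalSubring K} (hQ : Q ∈ excPoints A K) :
    Q.toSubring ≠ ⊤ := by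
  intro htop
  obtain ⟨q, hq0, hq⟩ := exists_excIdeal_eq_span hQ.1
  have hqm : q ∈ maximalIdeal Q.toSubring := hQ.2.2 (hq ▸ Ideal.mem_span_singleton_self q)
  have hinv : ∀ z : K, z ∈ Q.toSubring := fun z => htop ▸ Subring.mem_top z
  exact notMem_maximalIdeal_of_inv_mem Q hq0 (hinv _) hqm

/-- The prime divisor of an irreducible exceptional divisor is unique. -/
lemma eq_of_liesOver {P Q : LocalSubring K} (hQ : Q ∈ excPoints A K)
    (hirr : ∀ S ∈ excPoints A K, S.toSubring ≤ Q.toSubring)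
    (hP : P ∈ primeDivisors (blowup A K)) (hPo : LiesOver A P) {h : K} {k : ℤ}
    (hk : HasOrd P h k) : P = Q := by
  have := isNoetherianRing_of_mem_blowup hP.1
  have : IsFractionRing P.toSubring K := isFractionRing_of_le (range_le_of_mem_blowup hP.1)
  exact eq_of_le_of_isDiscreteValuationRing (isDiscreteValuationRing_of_hasOrd hP.2 hk)
    (hirr P ⟨hP.1, hPo⟩) (toSubring_ne_top_of_mem_excPoints hQ)

variable {A : Type*} [CommRing A] [IsLocalRing A] {K : Type*} [Field K] [Algebra A K] in
lemma liesOver_ofPrime_iff {W : LocalSubring K} {p : Ideal W.toSubring} [p.IsPrime]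
    (hle : (algebraMap A K).range ≤ W.toSubring) :
    LiesOver A (LocalSubring.ofPrime W.toSubring p) ↔ excIdeal A W ≤ p := by
  have hle' := LocalSubring.le_ofPrime W.toSubring p
  constructor
  · rintro ⟨-, h⟩
    refine Ideal.span_le.2 ?_
    rintro s ⟨a, ha, hs⟩
    exact (mem_maximalIdeal_ofPrime_iff rfl).1
      (h (Ideal.subset_span (a := ⟨s, hle' s.2⟩) ⟨a, ha, hs⟩))
  · refine fun h => ⟨fun a => hle' (hle ⟨a, rfl⟩), Ideal.span_le.2 ?_⟩
    rintro s ⟨a, ha, hs⟩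
    exact (mem_maximalIdeal_ofPrime_iff (a := ⟨algebraMap A K a, hle ⟨a, rfl⟩⟩) hs).2
      (h (Ideal.subset_span ⟨a, ha, rfl⟩))

variable {Q W : LocalSubring K} (hQ : Q ∈ excPoints A K)
  (hirr : ∀ S ∈ excPoints A K, S.toSubring ≤ Q.toSubring)
  (hord : ∀ P ∈ primeDivisors (blowup A K), ∃ (h : K) (k : ℤ), HasOrd P h k)
  (hW : W ∈ excPoints A K) (hrad : (excIdeal A W).IsRadical)
  {q : W.toSubring} (hq0 : (q : K) ≠ 0) (hq : excIdeal A W = Ideal.span {q})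

include hQ hirr hord hW hrad hq0 hq in
/-- The local equation of an irreducible reduced exceptional divisor is a prime element. -/
lemma exists_prime_excIdeal : ∃ (p : Ideal W.toSubring) (_ : p.IsPrime),
    Ideal.span {q} = p ∧ p.height = 1 ∧ Q = LocalSubring.ofPrime W.toSubring p := by
  have := isNoetherianRing_of_mem_blowup hW.1
  have hle := range_le_of_mem_blowup hW.1
  -- By Krull, a minimal prime of `q` has height one, so it is a prime divisor over `o` and its
  -- local ring is `Q`. Hence there is only one minimal prime, and the radical ideal generated by
  -- `q` equals it.
  have key : ∀ p ∈ (Ideal.span {q}).minimalPrimes, ∃ _ : p.IsPrime,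
      p.height = 1 ∧ Q = LocalSubring.ofPrime W.toSubring p := by
    intro p hp
    have hpp : p.IsPrime := hp.1.1
    have h1 : p.height ≤ 1 :=
      Ideal.height_le_one_of_isPrincipal_of_mem_minimalPrimes (Ideal.span {q}) p hp
    have h2 : p.height ≠ 0 := by
      rw [Ne, Ideal.height_eq_zero_iff, IsDomain.minimalPrimes_eq_singleton_bot]
      intro h
      have : q ∈ p := hp.1.2 (Ideal.mem_span_singleton_self q)
      rw [Set.mem_singleton_iff.1 h, Ideal.mem_bot] at this
      exact hq0 (congrArg Subtype.val this)
    have h3 : p.height = 1 := le_antisymm h1 (Order.one_le_iff_ne_zero.2 h2)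
    have hmem : LocalSubring.ofPrime W.toSubring p ∈ primeDivisors (blowup A K) :=
      ⟨ofPrime_mem_blowup hW.1 p, by rw [ringKrullDim_ofPrime, h3]; rfl⟩
    obtain ⟨h, k, hk⟩ := hord _ hmem
    refine ⟨hpp, h3, (eq_of_liesOver hQ hirr hmem ?_ hk).symm⟩
    exact (liesOver_ofPrime_iff hle).2 (hq ▸ hp.1.2)
  have hne : Ideal.span {q} ≠ ⊤ := by
    intro h
    have := hW.2.2
    rw [hq, h, top_le_iff] at this
    exact (maximalIdeal.isMaximal _).ne_top this
  obtain ⟨p, hp⟩ := Ideal.nonempty_minimalPrimes hne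
  obtain ⟨hpp, hp1, hpQ⟩ := key p hp
  refine ⟨p, hpp, ?_, hp1, hpQ⟩
  have hmin : (Ideal.span {q}).minimalPrimes = {p} := by
    refine Set.eq_singleton_iff_unique_mem.2 ⟨hp, fun p' hp' => ?_⟩
    obtain ⟨hpp', -, hpQ'⟩ := key p' hp'
    have h := hpQ.symm.trans hpQ'
    ext a
    rw [← mem_maximalIdeal_ofPrime_iff (P := p)
        (s := ⟨a, LocalSubring.le_ofPrime _ p a.2⟩) (a := a) rfl,
      ← mem_maximalIdeal_ofPrime_iff (P := p')
        (s := ⟨a, LocalSubring.le_ofPrime _ p' a.2⟩) (a := a) rfl]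
    have gen : ∀ (S T : LocalSubring K) (hST : S = T) (z : K) (hS : z ∈ S.toSubring)
        (hT : z ∈ T.toSubring), (⟨z, hT⟩ : T.toSubring) ∈ maximalIdeal T.toSubring ↔
          (⟨z, hS⟩ : S.toSubring) ∈ maximalIdeal S.toSubring := by
      rintro S _ rfl z _ _
      exact Iff.rfl
    exact gen _ _ h _ _ _
  rw [hq] at hrad
  rw [← hrad.radical, ← Ideal.sInf_minimalPrimes, hmin, sInf_singleton]

include hQ hirr hord hW hrad hq0 hq in
lemma prime_of_excIdeal_eq_span : Prime q := by
  obtain ⟨p, hp, h, -⟩ := exists_prime_excIdeal hQ hirr hord hW hrad hq0 hq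
  rw [← h] at hp
  exact (Ideal.span_singleton_prime fun h0 => hq0 (by rw [h0]; rfl)).1 hp

include hQ hirr hord hW hrad hq0 hq in
lemma le_exceptionalDivisor : W.toSubring ≤ Q.toSubring ∧ Q ∈ primeDivisors (blowup A K) := by
  obtain ⟨p, hp, -, h1, rfl⟩ := exists_prime_excIdeal hQ hirr hord hW hrad hq0 hq
  exact ⟨LocalSubring.le_ofPrime _ p, ofPrime_mem_blowup hW.1 p, by
    rw [ringKrullDim_ofPrime, h1]; rfl⟩

include hQ hirr hord hW hrad hq0 hq in
lemma hasOrd_exceptionalDivisor : HasOrd Q (q : K) 1 := by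
  obtain ⟨p, hp, hqp, h1, rfl⟩ := exists_prime_excIdeal hQ hirr hord hW hrad hq0 hq
  have hle := LocalSubring.le_ofPrime W.toSubring p
  refine ⟨hq0, ⟨q, hle q.2⟩, 1, le_antisymm ?_ ?_, by simp⟩
  · intro s hs
    obtain ⟨a, t, ht, hst⟩ := mem_ofPrime_iff.1 s.2
    have ha : a ∈ p := by
      have h := Ideal.mul_mem_right (⟨t, hle t.2⟩ : (LocalSubring.ofPrime _ p).toSubring) _ hs
      refine (mem_maximalIdeal_ofPrime_iff ?_).1 h
      rw [Subring.coe_mul, hst]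
      exact div_mul_cancel₀ _ (coe_ne_zero_of_notMem ht)
    rw [← hqp, Ideal.mem_span_singleton'] at ha
    obtain ⟨c, rfl⟩ := ha
    refine Ideal.mem_span_singleton'.2 ⟨⟨c / t, mem_ofPrime_iff.2 ⟨c, t, ht, rfl⟩⟩, Subtype.ext ?_⟩
    rw [Subring.coe_mul, hst, Subring.coe_mul, mul_div_right_comm]
  · rw [Ideal.span_singleton_le_iff_mem, mem_maximalIdeal_ofPrime_iff (a := q) rfl, ← hqp]
    exact Ideal.mem_span_singleton_self q

include hQ hirr hord hW hq0 hq in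
-- If `q` were not a unit at `P`, the whole ideal generated by it would vanish along `P`, so `P`
-- would lie over `o` and be `Q`.
lemma hasOrd_zero_of_ne {P : LocalSubring K} (hP : P ∈ primeDivisors (blowup A K))
    (hWP : W.toSubring ≤ P.toSubring) (hPQ : P ≠ Q) :
    P ∈ primeDivisors (germ A K) ∧ HasOrd P (q : K) 0 := by
  obtain ⟨h, k, hk⟩ := hord P hP
  have hle := range_le_of_mem_blowup hP.1
  have hPo : ¬ LiesOver A P := fun hPo => hPQ (eq_of_liesOver hQ hirr hP hPo hk)
  refine ⟨⟨mem_germ_of_not_liesOver hP.1 hPo, hP.2⟩, hk.of_unit (hWP q.2) ?_ hq0⟩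
  refine inv_mem_of_notMem_maximalIdeal P (z := ⟨q, hWP q.2⟩) fun hqP => hPo ?_
  refine ⟨fun a => hle ⟨a, rfl⟩, Ideal.span_le.2 ?_⟩
  rintro s ⟨a, ha, hs⟩
  have ha' : (⟨algebraMap A K a, hW.2.1 a⟩ : W.toSubring) ∈ Ideal.span {q} :=
    hq.le (Ideal.subset_span ⟨a, ha, rfl⟩)
  rw [Ideal.mem_span_singleton'] at ha'
  obtain ⟨c, hc⟩ := ha'
  have hsc : s = (⟨c, hWP c.2⟩ : P.toSubring) * ⟨q, hWP q.2⟩ := by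
    refine Subtype.ext ?_
    rw [hs, Subring.coe_mul]
    exact (congrArg Subtype.val hc).symm
  rw [hsc]
  exact Ideal.mul_mem_left _ _ hqP

include hQ hirr hord hW hrad hq0 hq in
/-- A rational function without poles along prime divisors is regular at a point of the reduced
irreducible exceptional divisor. -/
lemma mem_of_forall_hasOrd_of_mem_excPoints [IsIntegrallyClosed A] {h : K}
    (hh : ∀ (p : Ideal W.toSubring) [p.IsPrime], p.height = 1 →
      ∃ k : ℤ, 0 ≤ k ∧ HasOrd (LocalSubring.ofPrime W.toSubring p) h k) : h ∈ W.toSubring := by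
  have := isNoetherianRing_of_mem_blowup hW.1
  have hle := range_le_of_mem_blowup hW.1
  have : IsFractionRing W.toSubring K := isFractionRing_of_le hle
  refine mem_of_forall_height_one (fun p _ hp => ?_) fun P _ hP z hz => ?_
  · obtain ⟨k, hk, hhk⟩ := hh p hp
    exact hhk.mem hk
  -- Off the exceptional divisor the ring is a localization of the normal ring `A`. On it, `q` and
  -- any `x ∈ P` not divisible by `q` give depth two: the prime `q` divides `x * (q * z)`, hence
  -- divides `q * z`.
  · by_cases hqP : q ∈ P
    · obtain ⟨p, hp, hqp, h1, -⟩ := exists_prime_excIdeal hQ hirr hord hW hrad hq0 hq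
      have hprime := prime_of_excIdeal_eq_span hQ hirr hord hW hrad hq0 hq
      have hx : ∃ x ∈ P, x ∉ Ideal.span {q} := by
        by_contra! hcon
        have : P = p := le_antisymm (hqp ▸ hcon)
          (hqp ▸ (Ideal.span_singleton_le_iff_mem _).2 hqP)
        rw [this, h1] at hP
        exact lt_irrefl _ hP
      obtain ⟨x, hxP, hxq⟩ := hx
      have hdvd : q ∣ x * ⟨_, hz q hqP⟩ := ⟨⟨_, hz x hxP⟩, Subtype.ext (by
        simp only [Subring.coe_mul]; ring)⟩
      obtain ⟨c, hc⟩ := (hprime.dvd_or_dvd hdvd).resolve_left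
        fun h => hxq (Ideal.mem_span_singleton.2 h)
      have hc' : (q : K) * z = q * c := congrArg Subtype.val hc
      rw [mul_left_cancel₀ hq0 hc']
      exact LocalSubring.le_ofPrime _ P c.2
    · refine mem_ofPrime_of_mul_mem (isIntegrallyClosed_of_mem_germ (A := A) ?_) hP hz
      refine mem_germ_of_not_liesOver (ofPrime_mem_blowup hW.1 P) ?_
      rw [liesOver_ofPrime_iff hle, hq, Ideal.span_singleton_le_iff_mem]
      exact hqP

end ExceptionalDivisor

/-! ### Parameters adapted to the exceptional divisor. -/

section RegularCoordinates

/-- Lift parameters of the quotient and add `q`; since `q` is not a zero divisor, passing to the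
quotient drops the dimension by at least one. -/
lemma exists_span_eq_maximalIdeal_of_isRegularLocalRing_quotient {R : Type*} [CommRing R]
    [IsLocalRing R] {q : R} (hq : q ∈ nonZeroDivisors R)
    {I : Ideal R} (hI : I = Ideal.span {q})
    (hreg : IsRegularLocalRing (R ⧸ I)) : ∃ (r : ℕ) (y : Fin (r + 1) → R), y 0 = q ∧
      (r : WithBot ℕ∞) = ringKrullDim (R ⧸ I) ∧ Ideal.span (Set.range y) = maximalIdeal R ∧
      ((r + 1 : ℕ) : WithBot ℕ∞) ≤ ringKrullDim R := by
  subst hI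
  set π := Ideal.Quotient.mk (Ideal.span {q})
  obtain ⟨s, hs, hsm⟩ := (IsNoetherian.noetherian
    (maximalIdeal (R ⧸ Ideal.span {q}))).exists_span_finset_card_eq_spanFinrank
  have hdim : (s.card : WithBot ℕ∞) = ringKrullDim (R ⧸ Ideal.span {q}) := by
    rw [hs]; exact hreg.spanFinrank_maximalIdeal
  have hlift : ∀ i, ∃ a, π a = (s.equivFin.symm i : R ⧸ Ideal.span {q}) :=
    fun i => Ideal.Quotient.mk_surjective _
  choose y hy using hlift
  refine ⟨s.card, Fin.cons q y, rfl, hdim, ?_, ?_⟩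
  · have hmap : Ideal.map π (Ideal.span (Set.range y)) = maximalIdeal (R ⧸ Ideal.span {q}) := by
      rw [Ideal.map_span, ← hsm, ← Set.range_comp]
      congr 1
      ext z
      constructor
      · rintro ⟨i, rfl⟩
        rw [Function.comp_apply, hy]
        exact Subtype.prop _
      · intro hz
        refine ⟨s.equivFin ⟨z, hz⟩, ?_⟩
        rw [Function.comp_apply, hy]
        simp
    have : IsLocalHom π := IsLocalHom.of_surjective _ Ideal.Quotient.mk_surjective
    have hcomap : Ideal.comap π (maximalIdeal (R ⧸ Ideal.span {q})) = maximalIdeal R :=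
      ((IsLocalRing.local_hom_TFAE π).out 0 4).1 this
    rw [Fin.range_cons, Set.insert_eq, Ideal.span_union, ← hcomap, ← hmap,
      Ideal.comap_map_of_surjective' _ Ideal.Quotient.mk_surjective, Ideal.mk_ker, sup_comm]
  · have := ringKrullDim_quotient_succ_le_of_nonZeroDivisor hq
    rw [← hdim] at this
    exact_mod_cast this

end RegularCoordinates

/-! ### Orders of the coordinate volume form. -/

section CoordinateForms

variable {K : Type*} [Field K] [Algebra ℂ K] {d : ℕ}

lemma coordDerivation_mem_ofPrime {W : Subring K}
    (b : Module.Basis (Fin d) K Ω[K⁄ℂ])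
    (hR : ∀ a : W, ∀ i, coordDerivation b i (a : K) ∈ W) {p : Ideal W} [p.IsPrime] {z : K}
    (hz : z ∈ (LocalSubring.ofPrime W p).toSubring) (i : Fin d) :
    coordDerivation b i z ∈ (LocalSubring.ofPrime W p).toSubring := by
  obtain ⟨a, t, ht, rfl⟩ := mem_ofPrime_iff.1 hz
  refine mem_ofPrime_iff.2 ⟨t * ⟨_, hR a i⟩ - a * ⟨_, hR t i⟩, t * t,
    fun h => (Ideal.IsPrime.mem_or_mem inferInstance h).elim ht ht, ?_⟩
  have ht0 := coe_ne_zero_of_notMem ht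
  rw [Derivation.leibniz_div]
  push_cast
  simp only [smul_eq_mul]
  field_simp

/-- Coordinate derivations preserve the localization by the quotient rule, so Jacobian determinants
of its elements lie in it and the coordinate form generates the regular forms. -/
lemma hasOrdForm_wedgeD_ofPrime {W : Subring K} {x : Fin d → W}
    (b : Module.Basis (Fin d) K Ω[K⁄ℂ])
    (hb : ∀ j, b j = KaehlerDifferential.D ℂ K (x j : K))
    (hR : ∀ a : W, ∀ i, coordDerivation b i (a : K) ∈ W) (p : Ideal W) [p.IsPrime] {z : K} {k : ℤ}
    (hz : HasOrd (LocalSubring.ofPrime W p) z k) :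
    HasOrdForm (LocalSubring.ofPrime W p) (wedgeD fun i => (x i : K)) 0 := by
  set P := LocalSubring.ofPrime W p
  refine ⟨fun i => ⟨x i, LocalSubring.le_ofPrime W p (x i).2⟩, 1, wedgeD_ne_zero b hb, fun y => ?_,
    (one_smul _ _).symm, hz.one⟩
  set m : Matrix (Fin d) (Fin d) P.toSubring := Matrix.of fun i j =>
    ⟨coordDerivation b i (y j), coordDerivation_mem_ofPrime b hR (y j).2 i⟩
  refine ⟨m.det, ?_⟩
  have h := wedgeD_eq_det_smul b hb fun i => (y i : K)
  have h' : (m.det : K) = (Matrix.of fun i j => coordDerivation b i (y j : K)).det :=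
    RingHom.map_det P.toSubring.subtype m
  rw [h, h']

lemma HasOrdForm.ne_zero {P : LocalSubring K} {ω : ⋀[K]^d Ω[K⁄ℂ]} {k : ℤ}
    (h : HasOrdForm P ω k) : ω ≠ 0 := by
  obtain ⟨x, g, hx, -, rfl, hg⟩ := h
  exact smul_ne_zero hg.ne_zero hx

lemma exists_hasOrdForm_wedgeD {E : LocalSubring K} (hE : IsDiscreteValuationRing E.toSubring)
    [IsFractionRing E.toSubring K] {x : Fin d → K}
    (b : Module.Basis (Fin d) K Ω[K⁄ℂ]) (hb : ∀ i, b i = KaehlerDifferential.D ℂ K (x i))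
    (hx : ∀ i, x i ∈ E.toSubring) {ω : ⋀[K]^d Ω[K⁄ℂ]} {k : ℤ} (h : HasOrdForm E ω k) :
    ∃ j, HasOrdForm E (wedgeD x) j := by
  obtain ⟨ξ, g, hξ, hξ', -, -⟩ := h
  obtain ⟨c, hc⟩ := hξ' fun i => ⟨x i, hx i⟩
  have hc0 : (c : K) ≠ 0 := by
    intro h0
    apply wedgeD_ne_zero b hb
    rw [h0, zero_smul] at hc
    exact hc
  obtain ⟨j, hj⟩ := exists_hasOrd hE hc0
  exact ⟨j, ξ, c, hξ, hξ', hc, hj⟩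

end CoordinateForms

/-! ### The bound for a divisor with centre at a regular point. -/

section LogAdapted

variable {K : Type*} [Field K] [Algebra ℂ K] {d : ℕ}

/-- The bound for the values, along a prime divisor with centre `W`, of functions of bounded order
at `W` and along a hypersurface through `W`. -/
theorem hasOrd_add_mul_le {W E : LocalSubring K} [Algebra ℂ W.toSubring]
    [IsScalarTower ℂ W.toSubring K] (hWE : W ≤ E) (hE : IsDiscreteValuationRing E.toSubring)
    [IsFractionRing E.toSubring K] {x : Fin d → W.toSubring} (b : Module.Basis (Fin d) K Ω[K⁄ℂ])
    (hb : ∀ j, b j = KaehlerDifferential.D ℂ K (x j : K))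
    (hR : ∀ a : W.toSubring, KaehlerDifferential.D ℂ K (a : K) ∈
      Submodule.span W.toSubring (Set.range b)) {j : ℤ}
    (hj : HasOrdForm E (wedgeD fun i => (x i : K)) j) {T : Finset (Fin d)}
    (hT : Ideal.span (x '' T) = maximalIdeal W.toSubring) {i₀ j₀ : Fin d} (hi₀ : i₀ ∈ T)
    (hj₀ : j₀ ∈ T) (hij : i₀ ≠ j₀) {w s : ℤ} (hw : HasOrd E (x i₀ : K) w) (n M : ℕ) (c : ℤ)
    (hcn : c ≤ n) (hM : (M : ℤ) ≤ 2 * n - c) {f : W.toSubring}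
    (hf : f ∉ maximalIdeal W.toSubring ^ (n + 1))
    (hfq : f ∉ maximalIdeal W.toSubring ^ (M + 1) ⊔ Ideal.span {x i₀})
    (hs : HasOrd E (f : K) s) : s + c * w ≤ n * (j + 1) := by
  obtain ⟨hle, hloc⟩ := hWE
  obtain ⟨π, hπ⟩ := IsDiscreteValuationRing.exists_irreducible E.toSubring
  replace hπ : maximalIdeal E.toSubring = Ideal.span {π} := hπ.maximalIdeal_eq
  have hπ0 := coe_uniformizer_ne_zero hE hπ
  obtain ⟨δ, hδ, hδcomm, hδD⟩ := exists_dual_derivations (R := W.toSubring) b hb hR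
  have hmax : ∀ r : W.toSubring, (r : K) ∈ ordFiltration E (π : K) 1 ↔
      r ∈ maximalIdeal W.toSubring := by
    intro r
    have h1 : (Subring.inclusion hle r) ∈ maximalIdeal E.toSubring ↔
        r ∈ maximalIdeal W.toSubring := by
      have h2 : Ideal.comap (Subring.inclusion hle) (maximalIdeal E.toSubring) =
          maximalIdeal W.toSubring :=
        ((IsLocalRing.local_hom_TFAE (Subring.inclusion hle)).out 0 4).1 hloc
      rw [← h2, Ideal.mem_comap]
    rw [← h1, hπ, Ideal.mem_span_singleton', mem_ordFiltration]
    constructor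
    · intro h
      refine ⟨⟨_, h⟩, Subtype.ext ?_⟩
      rw [Subring.coe_mul]
      change (r : K) * (π : K) ^ (-1 : ℤ) * π = r
      rw [zpow_neg_one, inv_mul_cancel_right₀ hπ0]
    · rintro ⟨e, he⟩
      have he' : (e : K) * π = r := congrArg Subtype.val he
      rw [← he', zpow_neg_one, mul_inv_cancel_right₀ hπ0]
      exact e.2
  have hzero : ∀ r : W.toSubring, (r : K) ∈ ordFiltration E (π : K) 0 := by
    intro r
    rw [mem_ordFiltration, neg_zero, zpow_zero, mul_one]
    exact hle r.2
  have hxm : ∀ i ∈ T, x i ∈ maximalIdeal W.toSubring := fun i hi =>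
    hT ▸ Ideal.subset_span ⟨i, hi, rfl⟩
  -- The constant is the log discrepancy `j + 1`; domination of `W` by `E` gives the conditions on
  -- values 0 and 1.
  have hlog : IsLogAdapted (ordFiltration E (π : K)) (j + 1) T x δ (coordDerivation b) :=
    { isValuationFiltration_ordFiltration hE hπ with
      dual := hδ
      comm := hδcomm
      compat := hδD
      mem_zero := hzero
      mem_one := fun i hi => (hmax _).2 (hxm i hi)
      notMem_one := fun r hr h => hr (hT ▸ (hmax r).1 h)
      bracket := fun i k _ _ _ _ hg hh => bracket_mem_ordFiltration hE hπ b hb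
        (fun i => hle (x i).2) hj i k hg hh }
  have h1 : (1 : K) ∉ ordFiltration E (π : K) 1 := by
    intro h
    exact (Ideal.ne_top_iff_one _).1 (maximalIdeal.isMaximal W.toSubring).ne_top ((hmax 1).1 h)
  have hw0 : 0 < w := by
    by_contra! hw0
    have h2 := hw.inv.mem_ordFiltration hπ hπ0 (t := 0) (by omega)
    have h3 := hlog.mul_mem h2 ((hmax _).2 (hxm i₀ hi₀))
    rw [inv_mul_cancel₀ hw.ne_zero] at h3
    exact h1 h3
  exact hlog.add_mul_le hi₀ hj₀ hij hw0 (hw.mem_ordFiltration hπ hπ0 le_rfl) h1 n M c hcn hM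
    (by rwa [hT]) (by rwa [hT]) (hs.mem_ordFiltration hπ hπ0 le_rfl)

end LogAdapted

/-! ### Finiteness, multiplicities, and orders of pulled back divisors. -/

section EssFiniteType

variable {A : Type*} [CommRing A] [IsLocalRing A] [IsNoetherianRing A] [Algebra ℂ A]
  [Algebra.EssFiniteType ℂ A] {K : Type*} [Field K] [Algebra A K] [Algebra ℂ K]
  [IsScalarTower ℂ A K]

/-- The local rings of the blow-up are essentially of finite type over `ℂ`. -/
lemma essFiniteType_of_mem_blowup {W : LocalSubring K} (hW : W ∈ blowup A K)
    [Algebra ℂ W.toSubring] [IsScalarTower ℂ W.toSubring K] :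
    Algebra.EssFiniteType ℂ W.toSubring := by
  obtain ⟨x, -, -, P, hP, rfl⟩ := hW
  have := finiteType_blowupChart (K := K) x
  let : Algebra ℂ (blowupChart A K x).toSubring := inferInstanceAs (Algebra ℂ (blowupChart A K x))
  have h1 : Algebra.EssFiniteType ℂ (blowupChart A K x) :=
    Algebra.EssFiniteType.comp ℂ A (blowupChart A K x)
  have h2 : Algebra.EssFiniteType ℂ (blowupChart A K x).toSubring := h1
  have h3 : Algebra.EssFiniteType (blowupChart A K x).toSubring
      (LocalSubring.ofPrime (blowupChart A K x).toSubring P).toSubring :=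
    Algebra.EssFiniteType.of_isLocalization _ P.primeCompl
  have : IsScalarTower ℂ (blowupChart A K x).toSubring
      (LocalSubring.ofPrime (blowupChart A K x).toSubring P).toSubring := by
    refine IsScalarTower.of_algebraMap_eq fun c => Subtype.ext ?_
    have e1 := IsScalarTower.algebraMap_apply ℂ
      (LocalSubring.ofPrime (blowupChart A K x).toSubring P).toSubring K c
    have e2 := IsScalarTower.algebraMap_apply ℂ (blowupChart A K x) K c
    exact e1.symm.trans e2
  exact Algebra.EssFiniteType.comp ℂ (blowupChart A K x).toSubring _

end EssFiniteType

section Multiplicity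

lemma notMem_pow_of_orderIn_le {R : Type*} [CommRing R] {I : Ideal R} {f : R} {n : ℕ}
    (h : orderIn I f ≤ n) : f ∉ I ^ (n + 1) := by
  intro hf
  have h1 : ((n + 1 : ℕ) : ℕ∞) ≤ orderIn I f := le_iSup₂_of_le (n + 1) hf le_rfl
  have := h1.trans h
  norm_cast at this
  omega

end Multiplicity

section Discrepancy

variable {A : Type*} [CommRing A] [IsNoetherianRing A] [IsIntegrallyClosed A]
  {K : Type*} [Field K] [Algebra A K] [IsFractionRing A K]

/-- A rational function of order zero along the prime divisors of a normal germ has order zero along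
all the prime divisors over the germ. -/
lemma hasOrd_zero_of_forall_germ {E : LocalSubring K} (hAE : (algebraMap A K).range ≤ E.toSubring)
    {h z : K} {k : ℤ} (h0 : h ≠ 0) (hz : HasOrd E z k)
    (hh : ∀ P ∈ primeDivisors (germ A K), HasOrd P h 0) : HasOrd E h 0 := by
  refine hz.of_unit (hAE ?_) (hAE ?_) h0
  · exact mem_range_of_forall_hasOrd fun P hP => ⟨0, le_rfl, hh P hP⟩
  · exact mem_range_of_forall_hasOrd fun P hP => ⟨0, le_rfl, by simpa using (hh P hP).inv⟩

/-- Two rational functions, the divisors of which on the germ are multiples of the same divisor,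
have proportional orders along the prime divisors over the germ. -/
lemma mul_eq_mul_of_hasOrd {E : LocalSubring K} (hAE : (algebraMap A K).range ≤ E.toSubring)
    {D : LocalSubring K → ℤ} {g h : K} {r s : ℕ} {k l : ℤ}
    (hg : ∀ P ∈ primeDivisors (germ A K), HasOrd P g (r * D P))
    (hh : ∀ P ∈ primeDivisors (germ A K), HasOrd P h (s * D P))
    (hgE : HasOrd E g k) (hhE : HasOrd E h l) : s * k = r * l := by
  have h1 := (hgE.pow s).div (hhE.pow r)
  have h2 := hasOrd_zero_of_forall_germ hAE h1.ne_zero h1 fun P hP => by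
    convert ((hg P hP).pow s).div ((hh P hP).pow r) using 1
    ring
  have := h1.unique h2
  linarith

end Discrepancy

section PrimeDivisors

variable {A : Type*} [CommRing A] [IsLocalRing A] {K : Type*} [Field K] [Algebra A K]
  [IsFractionRing A K]

/-- A point over `o` has dimension `d > 1`, so the prime divisors of the germ survive on the
blow-up. -/
lemma mem_blowup_of_mem_primeDivisors_germ {d : ℕ} (hd : 3 ≤ d) (hdim : ringKrullDim A = d)
    {P : LocalSubring K} (hP : P ∈ primeDivisors (germ A K)) :
    P ∈ primeDivisors (blowup A K) ∧ ¬ LiesOver A P := by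
  have h : ¬ LiesOver A P := by
    intro h
    have := ringKrullDim_of_liesOver_of_mem_germ hP.1 h
    rw [hP.2, hdim] at this
    norm_cast at this
    omega
  exact ⟨⟨mem_blowup_of_mem_germ hP.1 h, hP.2⟩, h⟩

end PrimeDivisors

end

end LocalGerm

/-! ### Proof of the theorem. -/

open LocalGerm in
theorem theorem3p2
    {A : Type*} [CommRing A] [IsDomain A] [IsLocalRing A] [Algebra ℂ A]
    {K : Type*} [Field K] [Algebra A K] [IsFractionRing A K] [Algebra ℂ K] [IsScalarTower ℂ A K]
    -- `X = Spec A` is a germ of an isolated singularity, and `Q` is the exceptional divisor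
    (d : ℕ) (hd : 3 ≤ d) (hA : IsIsolatedGerm A d)
    (Q : LocalSubring K) (hG : ConditionG A d Q)
    -- the pair `(X, (1/n) D)`
    (n : ℕ) (hn : 0 < n) (D : LocalSubring K →₀ ℤ) (hD : IsEffectiveDivisor (germ A K) D)
    (hcan : IsCanonicalOutside A d n D)
    -- a non log canonical singularity `E ≠ Q` with centre `W ⊆ Q` on the blow-up
    (E : LocalSubring K) (hE : IsNonLCSingularity A d n D E) (hEQ : E ≠ Q)
    (W : LocalSubring K) (hW : W ∈ excPoints A K) (hWE : W ≤ E)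
    (hWreg : IsRegularLocalRing (W.toSubring ⧸ excIdeal A W))
    (hWcodim : 2 ≤ ringKrullDim (W.toSubring ⧸ excIdeal A W))
    -- the strict transform of `D` is linearly equivalent to `-ν Q`
    (ν : ℤ)
    (hν : LinEquiv (blowup A K) (strictTransform (blowup A K) D) (Finsupp.single Q (-ν)))
    (hν_le : ν ≤ 2 * n) :
    (n : ℕ∞) < multAlong (blowup A K) W (strictTransform (blowup A K) D) ∨
      ((3 * (n : ℤ) - ν).toNat : ℕ∞) <
        multRestrictAlong (blowup A K) W (excIdeal A W) (strictTransform (blowup A K) D) := by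
  classical
  have := hA.essFiniteType
  have := Algebra.EssFiniteType.isNoetherianRing ℂ A
  have := hA.normal
  have : Algebra.EssFiniteType ℂ K :=
    have : Algebra.EssFiniteType A K := .of_isLocalization K (nonZeroDivisors A)
    .comp ℂ A K
  obtain ⟨hE1, -, a, c, ⟨ω, KX, k, c₁, hω, hωE, ⟨r₁, g₁, k₁, hr₁, hg₁, hg₁E, hc₁⟩, ha⟩,
    ⟨r₂, g₂, k₂, hr₂, hg₂, hg₂E, hc₂⟩, hnlc⟩ := hE
  obtain ⟨ω', KX', k', c', hω', hωQ, ⟨r', g', l', hr', hg', hg'Q, hc'⟩, ha'⟩ :=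
    hG.discrepancy_eq_one
  obtain ⟨h, hh⟩ := hν
  set D' := strictTransform (blowup A K) D
  have hEdvr := hE1.1
  have hQ := hG.mem
  have hirr := hG.irreducible
  have hord : ∀ P ∈ primeDivisors (blowup A K), ∃ (h : K) (k : ℤ), HasOrd P h k :=
    fun P hP => ⟨h, _, hh P hP⟩
  have hrad := hG.reduced W hW
  have hleW := range_le_of_mem_blowup hW.1
  have hleE := hleW.trans hWE.1
  have : IsFractionRing W.toSubring K := isFractionRing_of_le hleW
  have : IsFractionRing E.toSubring K := isFractionRing_of_le hleE
  have := isNoetherianRing_of_mem_blowup hW.1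
  obtain ⟨q, hq0, hq⟩ := exists_excIdeal_eq_span hW.1
  have hQq := hasOrd_exceptionalDivisor hQ hirr hord hW hrad hq0 hq
  obtain ⟨hWQ, hQprime⟩ := le_exceptionalDivisor hQ hirr hord hW hrad hq0 hq
  obtain ⟨p₀, hp₀, -, hp₀1, hQp₀⟩ := exists_prime_excIdeal hQ hirr hord hW hrad hq0 hq
  -- coordinates at `W`
  have hCW : ∀ z : ℂ, algebraMap ℂ K z ∈ W.toSubring := fun z =>
    hleW ⟨algebraMap ℂ A z, (IsScalarTower.algebraMap_apply ℂ A K z).symm⟩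
  let : Algebra ℂ W.toSubring := ((algebraMap ℂ K).codRestrict W.toSubring hCW).toAlgebra
  have : IsScalarTower ℂ W.toSubring K := .of_algebraMap_eq fun _ => rfl
  have := essFiniteType_of_mem_blowup hW.1
  have hfin : Module.finrank K Ω[K⁄ℂ] = d :=
    finrank_kaehlerDifferential_of_hasOrdForm (by omega) hωE
  obtain ⟨r, y, hyq, hr, hy, hrdim⟩ := exists_span_eq_maximalIdeal_of_isRegularLocalRing_quotient
    (mem_nonZeroDivisors_of_ne_zero fun h0 => hq0 (congrArg Subtype.val h0)) hq hWreg
  rw [← hr] at hWcodim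
  have hr2 : 2 ≤ r := by exact_mod_cast hWcodim
  obtain ⟨x, e, b, he, hxy, hb, hbR⟩ := exists_coordinates hfin y hy hrdim
  have hxq : x (e 0) = q := (hxy 0).trans hyq
  have hT : Ideal.span (x '' (Finset.univ.image e : Finset (Fin d))) =
      maximalIdeal W.toSubring := by
    rw [← hy, Finset.coe_image, Finset.coe_univ, Set.image_univ, ← Set.range_comp]
    congr 2
    exact funext hxy
  have hRW : ∀ a : W.toSubring, ∀ i, coordDerivation b i (a : K) ∈ W.toSubring := by
    obtain ⟨δ, -, -, hδ⟩ := exists_dual_derivations (R := W.toSubring) b hb hbR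
    exact fun a i => (hδ i a) ▸ (δ i a).2
  have hmem : ∀ (p : Ideal W.toSubring) [p.IsPrime], p.height = 1 →
      LocalSubring.ofPrime W.toSubring p ∈ primeDivisors (blowup A K) := fun p _ hp =>
    ⟨ofPrime_mem_blowup hW.1 p, by rw [ringKrullDim_ofPrime, hp]; rfl⟩
  have hvol : ∀ (p : Ideal W.toSubring) [p.IsPrime], p.height = 1 →
      HasOrdForm (LocalSubring.ofPrime W.toSubring p) (wedgeD fun i => (x i : K)) 0 :=
    fun p _ hp => hasOrdForm_wedgeD_ofPrime b hb hRW p (hh _ (hmem p hp))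
  have hvolQ : HasOrdForm Q (wedgeD fun i => (x i : K)) 0 := hQp₀ ▸ hvol p₀ hp₀1
  obtain ⟨j, hj⟩ := exists_hasOrdForm_wedgeD hEdvr b hb (fun i => hWE.1 (x i).2) hωE
  obtain ⟨g, hgω⟩ := exists_eq_smul_wedgeD b hb ω
  obtain ⟨g₀, hg₀ω⟩ := exists_eq_smul_wedgeD b hb ω'
  have hg₀0 : g₀ ≠ 0 := by
    rintro rfl
    exact hωQ.ne_zero (by rw [hg₀ω, zero_smul])
  have hgE := hωE.hasOrd_of_eq_smul hj hgω
  have hg₀Q := hωQ.hasOrd_of_eq_smul hvolQ hg₀ω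
  obtain ⟨w, hw⟩ := exists_hasOrd hEdvr hq0
  obtain ⟨e₀, hg₀E⟩ := exists_hasOrd hEdvr hg₀0
  obtain ⟨l, hg'E⟩ := exists_hasOrd hEdvr hg'Q.ne_zero
  -- the discrepancy of `E` in terms of the volume form of the coordinates
  have hQeq : (r' : ℤ) * k' - l' = r' := by
    have : (r' : ℚ) * k' - l' = r' := by
      rw [← hc']
      linear_combination (-(r' : ℚ)) * ha'
    exact_mod_cast this
  -- Near `W` the canonical divisor of the blow-up is the pull-back of that of the germ plus `Q`.
  -- After multiplication by `r'`, this says that the present function is a unit at `W`, so it has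
  -- order zero along `E`.
  have hUE := ((hg₀E.pow r').div hg'E).div (hw.pow r')
  have hU : ∀ (p : Ideal W.toSubring) [p.IsPrime], p.height = 1 →
      HasOrd (LocalSubring.ofPrime W.toSubring p) (g₀ ^ r' / g' / (q : K) ^ r') 0 := by
    intro p _ hp
    by_cases hPQ : LocalSubring.ofPrime W.toSubring p = Q
    · rw [hPQ]
      convert ((hg₀Q.pow r').div hg'Q).div (hQq.pow r') using 1
      linarith
    · obtain ⟨hPg, hPq⟩ := hasOrd_zero_of_ne hQ hirr hord hW hq0 hq (hmem p hp)
        (LocalSubring.le_ofPrime _ p) hPQ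
      have := (hω' _ hPg).hasOrd_of_eq_smul (hvol p hp) hg₀ω
      convert ((this.pow r').div (hg' _ hPg)).div (hPq.pow r') using 1
      ring
  have hUE0 : HasOrd E (g₀ ^ r' / g' / (q : K) ^ r') 0 := by
    refine hw.of_unit (hWE.1 ?_) (hWE.1 ?_) hUE.ne_zero
    · exact mem_of_forall_hasOrd_of_mem_excPoints hQ hirr hord hW hrad hq0 hq
        fun p _ hp => ⟨0, le_rfl, hU p hp⟩
    · exact mem_of_forall_hasOrd_of_mem_excPoints hQ hirr hord hW hrad hq0 hq
        fun p _ hp => ⟨0, le_rfl, by simpa using (hU p hp).inv⟩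
  have hUeq := hUE.unique hUE0
  -- The discrepancies of `E` and `Q` are computed with different forms `ω`, `ω'` and multiples
  -- `r₁`, `r'`. This function compares them; it has order zero on the germ, hence along `E`.
  have hHE := ((hgE.div hg₀E).pow (r₁ * r')).mul ((hg'E.pow r₁).div (hg₁E.pow r'))
  have hH := hHE.unique (hasOrd_zero_of_forall_germ hleE hHE.ne_zero hHE fun P hP => by
    have hωω' : ω = (g / g₀) • ω' := by
      rw [hg₀ω, smul_smul, div_mul_cancel₀ _ hg₀0, hgω]
    have := (hω P hP).hasOrd_of_eq_smul (hω' P hP) hωω'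
    convert (this.pow (r₁ * r')).mul (((hg' P hP).pow r₁).div ((hg₁ P hP).pow r')) using 1
    push_cast
    ring)
  have haw : a = w + j := by
    have h1 : (r' : ℚ) * (r₁ * (k - j) - r₁ * w - k₁) = 0 := by
      have e1 : (r' : ℚ) * e₀ - l - r' * w = 0 := by exact_mod_cast hUeq
      have e2 : (r₁ * r' : ℚ) * (k - j - e₀) + (r₁ * l - r' * k₁) = 0 := by exact_mod_cast hH
      linear_combination e2 + r₁ * e1
    have h2 := (mul_eq_zero.1 h1).resolve_left (by positivity)
    have h3 : (r₁ : ℚ) * (k - j - w - c₁) = 0 := by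
      rw [← hc₁] at h2
      linear_combination h2
    have h4 := (mul_eq_zero.1 h3).resolve_left (by positivity)
    rw [ha]
    linear_combination h4
  -- the local equation of the strict transform of `D` at `W`
  have hgermD : ∀ P ∈ primeDivisors (germ A K), HasOrd P h (D P) := by
    intro P hP
    obtain ⟨hPb, hPo⟩ := mem_blowup_of_mem_primeDivisors_germ hd hA.dim_eq hP
    have hPQ : Q ≠ P := by
      rintro rfl
      exact hPo hQ.2
    have hDP : D' P = D P := Finsupp.filter_apply_pos _ _ hPb
    have := hh P hPb
    rwa [Finsupp.single_eq_of_ne' hPQ, sub_zero, hDP] at this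
  obtain ⟨s, hs⟩ := exists_hasOrd hEdvr (hh Q hQprime).ne_zero
  have hcs : c = s := by
    have h1 := mul_eq_mul_of_hasOrd hleE (D := D) hg₂ (s := 1) (fun P hP => by
      simpa using hgermD P hP) hg₂E hs
    have h2 : (r₂ : ℚ) * (c - s) = 0 := by
      have : (k₂ : ℚ) = r₂ * s := by
        rw [Nat.cast_one, one_mul] at h1
        exact_mod_cast h1
      rw [mul_sub, hc₂, this, sub_self]
    have h3 := (mul_eq_zero.1 h2).resolve_left (by positivity)
    linear_combination h3
  have hDpos : ∀ P, 0 ≤ D' P := by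
    intro P
    change 0 ≤ Finsupp.filter _ D P
    rw [Finsupp.filter_apply]
    split_ifs
    · exact hD.1 P
    · exact le_rfl
  -- The order of `h` along `Q` exceeds the multiplicity of the strict transform by `ν`; the factor
  -- `q ^ (-ν)` removes this excess and is a unit along the other divisors through `W`.
  have hfP : ∀ P ∈ primeDivisors (blowup A K), W.toSubring ≤ P.toSubring →
      HasOrd P (h * (q : K) ^ (-ν)) (D' P) := by
    intro P hP hWP
    by_cases hPQ : P = Q
    · subst hPQ
      convert (hh P hP).mul (hQq.zpow (-ν)) using 1
      rw [Finsupp.single_eq_same]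
      ring
    · obtain ⟨-, hPq⟩ := hasOrd_zero_of_ne hQ hirr hord hW hq0 hq hP hWP hPQ
      convert (hh P hP).mul (hPq.zpow (-ν)) using 1
      rw [Finsupp.single_eq_of_ne hPQ]
      ring
  have hfW : h * (q : K) ^ (-ν) ∈ W.toSubring :=
    mem_of_forall_hasOrd_of_mem_excPoints hQ hirr hord hW hrad hq0 hq fun p _ hp =>
      ⟨_, hDpos _, hfP _ (hmem p hp) (LocalSubring.le_ofPrime _ p)⟩
  set f : W.toSubring := ⟨_, hfW⟩
  have hfloc : IsLocalEquation (blowup A K) W D' f := hfP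
  by_contra! hcon
  obtain ⟨hcon1, hcon2⟩ := hcon
  have hf1 : f ∉ maximalIdeal W.toSubring ^ (n + 1) :=
    notMem_pow_of_orderIn_le ((le_iSup₂_of_le f hfloc le_rfl).trans hcon1)
  have hf2 : f ∉ maximalIdeal W.toSubring ^ ((3 * (n : ℤ) - ν).toNat + 1) ⊔
      Ideal.span {x (e 0)} := by
    intro hmem
    refine notMem_pow_of_orderIn_le ((le_iSup₂_of_le f hfloc le_rfl).trans hcon2) ?_
    have := Ideal.mem_map_of_mem (Ideal.Quotient.mk (excIdeal A W)) hmem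
    rw [Ideal.map_sup, hxq, ← hq, Ideal.map_quotient_self, sup_bot_eq, Ideal.map_pow] at this
    exact this
  -- Take `c = ν - n`: then `c ≤ n` is `ν ≤ 2 n`, and `2 n - c = 3 n - ν`, which is nonnegative, so
  -- `toNat` loses nothing.
  have hbound := hasOrd_add_mul_le hWE hEdvr b hb hbR hj hT (i₀ := e 0) (j₀ := e 1) (by simp)
    (by simp) (fun h01 => by
      have := congrArg Fin.val (he h01)
      rw [Fin.val_zero, Fin.val_one', Nat.mod_eq_of_lt (by omega)] at this
      omega) (by rw [hxq]; exact hw) n _ (ν - n) (by linarith)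
    (by rw [Int.toNat_of_nonneg (by linarith)]; linarith) hf1 hf2 (hs.mul (hw.zpow (-ν)))
  have hbound' : (s : ℚ) + -ν * w + (ν - n) * w ≤ n * (j + 1) := by exact_mod_cast hbound
  rw [haw, hcs] at hnlc
  linarith
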